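/- A topograph is a tree drawn in the oriented plane, with all vertices of degree $3$, whose complementary regions are labelled by integers so that $r+u=2(s+t)$ around every edge, where $s,t$ label the regions on the two sides of the edge and $r,u$ the regions at its initial and final end. The edge, directed from $r$ to $u$, has the label $s+t-r$, which changes sign when the direction is reversed. The discriminant is $D=-ef-fg-ge$, where $e,f,g$ are the labels of the three edges directed away from a vertex, and the gcd of the labels of the three regions at a vertex is called the region gcd; both are independent of the vertex. A topograph is primitive if its region gcd is $1$. The river consists of the edges separating a positive region from a negative one; such an edge is directed rightwards if the positive region is on its left-hand side. For a non-square integer $D>0$ put $\varepsilon_D=(t_D+u_D\sqrt D)/2$, where $(t_D,u_D)$ is the smallest solution of $t^2-Du^2=4$ in positive integers. **Theorem 9.3.** Let $\mathcal T$ be a topograph of non-square discriminant $D>0$. Let $\mathcal T_\star$ equal $\mathcal T$ except that every river edge is relabelled with $\sqrt D$ when directed rightwards (hence with $-\sqrt D$ when directed leftwards). If $\mathcal T$ is primitive, then $$\sum_{v}\left(\frac{D^{5/2}\,|e+f+g|}{|efg|^2}+\frac{D^{9/2}}{3\,|efg|^3}\right)=2\log\varepsilon_D ,$$ where $v$ runs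 over the vertices of $\mathcal T_\star$ modulo the river period, that is, modulo the orientation- and label-preserving symmetries of $\mathcal T$ (its translations along the river by whole periods), each class of vertices contributes one term, and $e,f,g$ are the labels in $\mathcal T_\star$ of the three edges directed away from $v$. The series converges absolutely. In general, if $\mathcal T$ has region gcd $g_0$, the same sum equals $2\log\varepsilon_{D/g_0^2}$. -/

import Mathlib

/-- A tree drawn in the (oriented) plane in which every vertex has degree `3`. The drawing is
recorded by the rotation system `rot`: for a directed edge `d` (a dart, pointing away from the
vertex `d.fst`), `rot d` is the next edge, counterclockwise, pointing away from the same vertex.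
Since the degree is `3`, the conditions on `rot` say that it permutes the three edges leaving each
vertex cyclically. -/
structure PlaneCubicTree (V : Type*) where
  graph : SimpleGraph V
  isTree : graph.IsTree
  degree_eq_three : ∀ v : V, (graph.neighborSet v).ncard = 3
  rot : graph.Dart → graph.Dart
  rot_fst : ∀ d, (rot d).fst = d.fst
  rot_ne : ∀ d, rot d ≠ d
  rot_rot_rot : ∀ d, rot (rot (rot d)) = d

namespace PlaneCubicTree

variable {V : Type*} (P : PlaneCubicTree V)

/-- Go forward along `d` and turn left at its end: counterclockwise from the way back `d.symm`
come first the right turn, then the left turn. -/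
def turnLeft (d : P.graph.Dart) : P.graph.Dart := P.rot (P.rot d.symm)

/-- The regions into which the tree divides the plane. A region is given by its border, followed
with the region on the left hand side: two darts have the same region on their left when one is
reached from the other by left turns. -/
def Region : Type _ := Quot (fun d d' : P.graph.Dart => d' = P.turnLeft d)

/-- The region on the left of a directed edge. -/
def leftRegion (d : P.graph.Dart) : P.Region := Quot.mk _ d

/-- The region on the right of a directed edge. -/
def rightRegion (d : P.graph.Dart) : P.Region := P.leftRegion d.symm

/-- The region at the initial vertex of `d` that does not border `d`. -/
def backRegion (d : P.graph.Dart) : P.Region := P.leftRegion (P.rot d)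

/-- The region at the final vertex of `d` that does not border `d`. -/
def frontRegion (d : P.graph.Dart) : P.Region := P.backRegion d.symm

theorem exists_dart (v : V) : ∃ d : P.graph.Dart, d.fst = v := by
  have h : (P.graph.neighborSet v).Nonempty := by
    apply Set.nonempty_of_ncard_ne_zero
    rw [P.degree_eq_three v]
    decide
  obtain ⟨w, hw⟩ := h
  exact ⟨⟨(v, w), hw⟩, rfl⟩

/-- The edges leaving a vertex are `d`, `rot d` and `rot (rot d)`, for any one `d` of them. -/
theorem eq_or_of_fst_eq (d d' : P.graph.Dart) (h : d'.fst = d.fst) :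
    d' = d ∨ d' = P.rot d ∨ d' = P.rot (P.rot d) := by
  have key : ∀ a b : P.graph.Dart, a.fst = b.fst → a.snd = b.snd → a = b := by
    intro a b h1 h2
    exact SimpleGraph.Dart.ext _ _ (Prod.ext h1 h2)
  have f1 : (P.rot d).fst = d.fst := P.rot_fst d
  have f2 : (P.rot (P.rot d)).fst = d.fst := (P.rot_fst _).trans f1
  have n1 : d.snd ≠ (P.rot d).snd := fun e => P.rot_ne d (key _ _ f1 e.symm)
  have n2 : (P.rot d).snd ≠ (P.rot (P.rot d)).snd :=
    fun e => P.rot_ne (P.rot d) (key _ _ (P.rot_fst _) e.symm)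
  have n3 : d.snd ≠ (P.rot (P.rot d)).snd := by
    intro e
    have e2 : P.rot (P.rot d) = d := key _ _ f2 e.symm
    have e3 := P.rot_rot_rot d
    rw [e2] at e3
    exact P.rot_ne d e3
  have hsub : ({d.snd, (P.rot d).snd, (P.rot (P.rot d)).snd} : Set V) ⊆
      P.graph.neighborSet d.fst := by
    rintro w (rfl | rfl | rfl)
    · exact d.adj
    · have := (P.rot d).adj
      rwa [f1] at this
    · have := (P.rot (P.rot d)).adj
      rwa [f2] at this
  have hcard : ({d.snd, (P.rot d).snd, (P.rot (P.rot d)).snd} : Set V).ncard = 3 :=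
    Set.ncard_eq_three.2 ⟨_, _, _, n1, n3, n2, rfl⟩
  have hfin : (P.graph.neighborSet d.fst).Finite := by
    apply Set.finite_of_ncard_ne_zero
    rw [P.degree_eq_three]
    decide
  have heq := Set.eq_of_subset_of_ncard_le hsub
    (by rw [hcard, P.degree_eq_three]) hfin
  have hmem : d'.snd ∈ P.graph.neighborSet d.fst := by
    have := d'.adj
    rwa [h] at this
  rw [← heq] at hmem
  rcases hmem with e | e | e
  · exact Or.inl (key _ _ h e)
  · exact Or.inr (Or.inl (key _ _ (h.trans f1.symm) e))
  · exact Or.inr (Or.inr (key _ _ (h.trans f2.symm) e))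

end PlaneCubicTree

/-- An (integer) topograph: a plane cubic tree with regions labelled by integers such that
`r + u = 2 * (s + t)` around every edge, where `s`, `t` are the labels on the two sides of the edge
and `r`, `u` are the labels of the regions at its two ends. -/
structure Topograph (V : Type*) extends PlaneCubicTree V where
  label : toPlaneCubicTree.Region → ℤ
  label_rule : ∀ d : graph.Dart,
    label (toPlaneCubicTree.backRegion d) + label (toPlaneCubicTree.frontRegion d) =
      2 * (label (toPlaneCubicTree.leftRegion d) + label (toPlaneCubicTree.rightRegion d))

namespace Topograph

variable {V : Type*} (T : Topograph V)

/-- The label of a directed edge: the common difference of the arithmetic progression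
`r`, `s + t`, `u` met along it. -/
def edgeLabel (d : T.graph.Dart) : ℤ :=
  T.label (T.leftRegion d) + T.label (T.rightRegion d) - T.label (T.backRegion d)

/-- The topograph has discriminant `D`: at every vertex `D = -ef - fg - ge`, where `e`, `f`, `g`
are the labels of the three edges directed away from the vertex. (This quantity is the same at all
vertices of a topograph.) -/
def HasDiscriminant (D : ℤ) : Prop :=
  ∀ d : T.graph.Dart,
    -(T.edgeLabel d * T.edgeLabel (T.rot d))
      - T.edgeLabel (T.rot d) * T.edgeLabel (T.rot (T.rot d))
      - T.edgeLabel (T.rot (T.rot d)) * T.edgeLabel d = D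

/-- At every vertex the labels of the three adjacent regions have greatest common divisor `g`.
(This quantity is the same at all vertices of a topograph.) -/
def HasRegionGcd (g : ℕ) : Prop :=
  ∀ d : T.graph.Dart,
    Int.gcd (T.label (T.leftRegion d))
      (Int.gcd (T.label (T.leftRegion (T.rot d)))
        (T.label (T.leftRegion (T.rot (T.rot d))))) = g

/-- A topograph is primitive if its region gcd is `1`. -/
def IsPrimitive : Prop := T.HasRegionGcd 1

/-- A river edge, directed rightwards: the river consists of the edges that separate a positive
region from a negative one, and the plane is oriented so that the positive regions are above the
river, i.e. on the left hand side when following it rightwards. -/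
def IsRightwardRiverEdge (d : T.graph.Dart) : Prop :=
  0 < T.label (T.leftRegion d) ∧ T.label (T.rightRegion d) < 0

open Classical in
/-- The edge labels after all river edges are relabelled with `√D` when directed rightwards
(and hence with `-√D` when directed leftwards). -/
noncomputable def starLabel (D : ℤ) (d : T.graph.Dart) : ℝ :=
  if T.IsRightwardRiverEdge d then Real.sqrt D
  else if T.IsRightwardRiverEdge d.symm then -Real.sqrt D
  else (T.edgeLabel d : ℝ)

/-- The summand at the vertex `d.fst`, in terms of the modified labels `e`, `f`, `g` of the three
edges directed away from it. -/
noncomputable def termAt (D : ℤ) (d : T.graph.Dart) : ℝ :=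
  let e := T.starLabel D d
  let f := T.starLabel D (T.rot d)
  let g := T.starLabel D (T.rot (T.rot d))
  (D : ℝ) ^ (5 / 2 : ℝ) * |e + f + g| / |e * f * g| ^ 2 +
    (D : ℝ) ^ (9 / 2 : ℝ) / (3 * |e * f * g| ^ 3)

theorem termAt_rot (D : ℤ) (d : T.graph.Dart) : T.termAt D (T.rot d) = T.termAt D d := by
  simp only [termAt, T.rot_rot_rot]
  rw [show T.starLabel D (T.rot d) + T.starLabel D (T.rot (T.rot d)) + T.starLabel D d =
      T.starLabel D d + T.starLabel D (T.rot d) + T.starLabel D (T.rot (T.rot d)) by ring,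
    show T.starLabel D (T.rot d) * T.starLabel D (T.rot (T.rot d)) * T.starLabel D d =
      T.starLabel D d * T.starLabel D (T.rot d) * T.starLabel D (T.rot (T.rot d)) by ring]

/-- The summand at a vertex; by `vertexTerm_eq` it may be computed from any of the edges leaving
the vertex. -/
noncomputable def vertexTerm (D : ℤ) (v : V) : ℝ :=
  T.termAt D (T.exists_dart v).choose

theorem vertexTerm_eq (D : ℤ) (d : T.graph.Dart) : T.vertexTerm D d.fst = T.termAt D d := by
  have h := (T.exists_dart d.fst).choose_spec
  rcases T.eq_or_of_fst_eq d _ h with e | e | e <;>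
    simp only [vertexTerm, e, termAt_rot]

/-- The symmetries of a labelled topograph: the automorphisms of the tree that preserve the
orientation of the drawing and all region labels. Such a map carries the river to itself,
preserving its direction and labels; for a topograph with an infinite periodic river these
symmetries are exactly the translations along the river by a whole number of periods. -/
structure Symmetry where
  toIso : T.graph ≃g T.graph
  map_rot : ∀ d, toIso.toHom.mapDart (T.rot d) = T.rot (toIso.toHom.mapDart d)
  label_map : ∀ d, T.label (T.leftRegion (toIso.toHom.mapDart d)) = T.label (T.leftRegion d)

variable {T} in
theorem Symmetry.termAt_map (φ : T.Symmetry) (D : ℤ) (d : T.graph.Dart) :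
    T.termAt D (φ.toIso.toHom.mapDart d) = T.termAt D d := by
  have hs : ∀ d : T.graph.Dart,
      (φ.toIso.toHom.mapDart d).symm = φ.toIso.toHom.mapDart d.symm := fun _ => rfl
  have h : ∀ d, T.starLabel D (φ.toIso.toHom.mapDart d) = T.starLabel D d := by
    intro d
    have h1 : ∀ d, T.IsRightwardRiverEdge (φ.toIso.toHom.mapDart d) ↔
        T.IsRightwardRiverEdge d := by
      intro d
      simp only [IsRightwardRiverEdge, PlaneCubicTree.rightRegion, hs, φ.label_map]
    have h2 : T.edgeLabel (φ.toIso.toHom.mapDart d) = T.edgeLabel d := by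
      simp only [edgeLabel, PlaneCubicTree.rightRegion, PlaneCubicTree.backRegion, hs,
        ← φ.map_rot, φ.label_map]
    classical
    exact if_congr (h1 d) rfl (if_congr (h1 d.symm) rfl (congrArg _ h2))
  simp only [termAt, ← φ.map_rot, h]

/-- Two vertices are identified modulo the river period when a symmetry of the labelled topograph
takes one to the other. -/
def riverSetoid : Setoid V where
  r v w := ∃ φ : T.Symmetry, φ.toIso v = w
  iseqv :=
    { refl := fun v => ⟨⟨SimpleGraph.Iso.refl, fun _ => rfl, fun _ => rfl⟩, rfl⟩
      symm := by
        rintro v w ⟨φ, rfl⟩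
        have hinv : ∀ d : T.graph.Dart,
            φ.toIso.symm.toHom.mapDart (φ.toIso.toHom.mapDart d) = d := by
          intro d
          exact SimpleGraph.Dart.ext _ _
            (Prod.ext (φ.toIso.symm_apply_apply d.fst) (φ.toIso.symm_apply_apply d.snd))
        have hinv' : ∀ d : T.graph.Dart,
            φ.toIso.toHom.mapDart (φ.toIso.symm.toHom.mapDart d) = d := by
          intro d
          exact SimpleGraph.Dart.ext _ _
            (Prod.ext (φ.toIso.apply_symm_apply d.fst) (φ.toIso.apply_symm_apply d.snd))
        refine ⟨⟨φ.toIso.symm, fun d => ?_, fun d => ?_⟩, φ.toIso.symm_apply_apply v⟩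
        · have := φ.map_rot (φ.toIso.symm.toHom.mapDart d)
          rw [hinv'] at this
          rw [← this, hinv]
        · rw [← φ.label_map, hinv']
      trans := by
        rintro u v w ⟨φ, rfl⟩ ⟨ψ, rfl⟩
        refine ⟨⟨φ.toIso.trans ψ.toIso, fun d => ?_, fun d => ?_⟩, rfl⟩
        · exact (congrArg _ (φ.map_rot d)).trans (ψ.map_rot _)
        · exact (ψ.label_map (φ.toIso.toHom.mapDart d)).trans (φ.label_map d) }

/-- The vertices of the topograph modulo the river period. -/
def VertexClass : Type _ := Quotient T.riverSetoid

/-- The summand at a vertex modulo the river period. -/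
noncomputable def classTerm (D : ℤ) : T.VertexClass → ℝ :=
  Quotient.lift (T.vertexTerm D) (by
    rintro v w ⟨φ, rfl⟩
    obtain ⟨d, rfl⟩ := T.exists_dart v
    rw [T.vertexTerm_eq, ← φ.termAt_map]
    exact (T.vertexTerm_eq D (φ.toIso.toHom.mapDart d)).symm)

end Topograph

/-- The solutions of `t ^ 2 - D * u ^ 2 = 4` in positive integers `(t, u)`. -/
def pellSolutions (D : ℤ) : Set (ℤ × ℤ) :=
  {p | 0 < p.1 ∧ 0 < p.2 ∧ p.1 ^ 2 - D * p.2 ^ 2 = 4}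

open Classical in
/-- `ε_D = (t_D + u_D * √D) / 2`, where `(t_D, u_D)` is the smallest solution of
`t ^ 2 - D * u ^ 2 = 4` in positive integers. For non-square `D > 0` there is one
(`exists_smallest_pellSolution`); the value `1` is a default for other `D`. -/
noncomputable def pellUnit (D : ℤ) : ℝ :=
  if h : ∃ p, IsLeast (pellSolutions D) p then (h.choose.1 + h.choose.2 * Real.sqrt D) / 2 else 1

theorem exists_smallest_pellSolution (D : ℤ) (hD : 0 < D) (hsq : ¬ IsSquare D) :
    ∃ p, IsLeast (pellSolutions D) p := by
  have hex : ∃ n : ℕ, ∃ t : ℤ, (t, (n : ℤ)) ∈ pellSolutions D := by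
    obtain ⟨x, y, h, hy⟩ := Pell.exists_of_not_isSquare hD hsq
    have hx : x ≠ 0 := by
      rintro rfl
      nlinarith [sq_nonneg y]
    refine ⟨(2 * y).natAbs, |2 * x|, ?_, ?_, ?_⟩
    · positivity
    · simpa using hy
    · simp only [Int.natCast_natAbs, sq_abs]
      linear_combination 4 * h
  classical
  obtain ⟨t, ht⟩ := Nat.find_spec hex
  refine ⟨(t, (Nat.find hex : ℤ)), ht, ?_⟩
  rintro ⟨t', u'⟩ h'
  obtain ⟨n, rfl⟩ := Int.eq_ofNat_of_zero_le h'.2.1.le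
  have hle : Nat.find hex ≤ n := Nat.find_min' hex ⟨t', h'⟩
  have hle' : (Nat.find hex : ℤ) ≤ (n : ℤ) := by exact_mod_cast hle
  obtain ⟨h1, h2, h3⟩ := ht
  obtain ⟨h1', h2', h3'⟩ := h'
  simp only at h1 h2 h3 h1' h2' h3'
  refine ⟨?_, hle'⟩
  simp only
  have hu : (Nat.find hex : ℤ) ^ 2 ≤ (n : ℤ) ^ 2 := by gcongr
  have : t ^ 2 ≤ t' ^ 2 := by nlinarith
  exact (sq_le_sq₀ h1.le h1'.le).1 this

/-! Put s = √D. Every edge carries the weight artanh(s/|e|), defined off the river because |e| > s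
there. At a vertex off the river, with one edge label e coming in from the river side and labels f,
g going out, the discriminant relation says precisely that this weight is additive: artanh(s/|e|) =
artanh(s/|f|) + artanh(s/|g|) (`artanh_div_eq_add`). Removing the first two Taylor terms from the
weight leaves a `tail` of higher order. Additivity of the weights turns tail(e) - tail(f) - tail(g)
into an odd cubic expression in the s/|label|, and by Newton's identity this is the summand of the
series (`edgeSummand_eq_artanhTail`).

The tails are absolutely summable over the classes of edges off the river, so the sum over the
vertices off the river telescopes to the tails of the edges that leave the river
(`hasSum_isClimbing`). At a river vertex the labels ±√D make the summand equal to the two removed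
Taylor terms of the leaving edge. Altogether there remains the finite sum of artanh(s/|e|) over the
edges leaving the river in one period (`hasSum_frontTerm`).

That sum is evaluated by the quadratic form read off at a river edge. Moving along the river changes
a basis of ℤ² by adding one vector to the other, and each artanh is the change of a logarithmic
height, built from the quotients of the two real linear factors of the form (`logHeight_step`).
After a period the basis change is an automorph of the form, that is, a solution of Pell's equation
with unit η, and the height has grown by 2 log η (`logHeight_of_pell`). Every positive solution
occurs in this way, hence the least period gives the smallest unit
(`finsum_artanh_eq_log_pellUnit`).

Everything is computed on flags, the three labels around a directed edge. A flag determines the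
labelling up to an oriented automorphism of the tree, so classes of vertices correspond to flags of
edges pointing away from the river or rightwards along it (`hasSum_classTerm_iff`). -/

namespace SimpleGraph

/-! ### Equivariant maps on the darts of a plane cubic tree -/

/-- On a tree, a system of permutations of `S` attached to the directed edges, inverse for opposite
directions, has a parallel section with any prescribed value at a vertex. -/
theorem IsTree.exists_parallel_section {V S : Type*} {G : SimpleGraph V} (hG : G.IsTree)
    (τ : G.Dart → Equiv.Perm S) (hτ : ∀ d, τ d.symm = (τ d)⁻¹) (r : V) (s : S) :
    ∃ f : V → S, f r = s ∧ ∀ d : G.Dart, f d.snd = τ d (f d.fst) := by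
  classical
  choose p hp huniq using fun v => hG.existsUnique_path r v
  let tr : ∀ {v : V}, G.Walk r v → S := fun q => q.darts.foldl (fun s d => τ d s) s
  have hconcat : ∀ {v w : V} (q : G.Walk r v) (h : G.Adj v w),
      tr (q.concat h) = τ ⟨(v, w), h⟩ (tr q) := by
    intro v w q h
    simp [tr, Walk.darts_concat, List.concat_eq_append]
  refine ⟨fun v => tr (p v), ?_, ?_⟩
  · have : p r = Walk.nil := (huniq r Walk.nil Walk.IsPath.nil).symm
    simp [this, tr]
  · rintro ⟨⟨v, w⟩, h⟩
    change tr (p w) = τ _ (tr (p v))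
    -- Of two adjacent vertices one lies on the path from `r` to the other, so one of the two paths
    -- extends the other by the edge in question.
    by_cases hv : v ∈ (p w).support
    · rw [hG.isAcyclic.path_concat (hp v) (hp w) h hv, hconcat]
    · have hw := hG.isAcyclic.mem_support_of_ne_mem_support_of_adj_of_isPath (hp v) (hp w) h hv
      rw [hG.isAcyclic.path_concat (hp w) (hp v) h.symm hw, hconcat]
      have := hτ ⟨(v, w), h⟩
      change τ ⟨(w, v), h.symm⟩ = _ at this
      rw [this]
      simp

end SimpleGraph

namespace PlaneCubicTree

variable {V : Type*} (P : PlaneCubicTree V)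

/-- The tree is connected and the three darts at a vertex form one orbit of `rot`, so `rot` and
`symm` lead from `d₀` to every dart. -/
theorem dart_induction {motive : P.graph.Dart → Prop} (d₀ : P.graph.Dart) (h₀ : motive d₀)
    (hrot : ∀ d, motive d → motive (P.rot d)) (hsymm : ∀ d, motive d → motive d.symm) :
    ∀ d, motive d := by
  have hall : ∀ d d' : P.graph.Dart, d'.fst = d.fst → motive d → motive d' := by
    intro d d' h hd
    rcases P.eq_or_of_fst_eq d d' h with rfl | rfl | rfl
    · exact hd
    · exact hrot _ hd
    · exact hrot _ (hrot _ hd)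
  have hwalk : ∀ {u v : V} (_ : P.graph.Walk u v),
      (∀ d : P.graph.Dart, d.fst = u → motive d) → ∀ d : P.graph.Dart, d.fst = v → motive d := by
    intro u v p
    induction p with
    | nil => exact id
    | cons h _ ih =>
      intro hu
      exact ih fun d hd => hall (SimpleGraph.Dart.symm ⟨(_, _), h⟩) d hd (hsymm _ (hu _ rfl))
  intro d
  obtain ⟨p⟩ := P.isTree.connected.preconnected d₀.fst d.fst
  exact hwalk p (fun d hd => hall d₀ d hd h₀) d rfl

/-- Equivariant maps from darts to a set with an involution `σ` and a permutation `ρ` of order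
dividing `3` exist with any prescribed value at a dart. -/
theorem exists_equivariant {X : Type*} (σ ρ : Equiv.Perm X) (hσ : σ * σ = 1) (hρ : ρ ^ 3 = 1)
    (d₀ : P.graph.Dart) (x₀ : X) :
    ∃ F : P.graph.Dart → X, F d₀ = x₀ ∧ (∀ d, F (P.rot d) = ρ (F d)) ∧
      ∀ d : P.graph.Dart, F d.symm = σ (F d) := by
  classical
  choose b hb using P.exists_dart
  have hn : ∀ d : P.graph.Dart, ∃ n : ℕ, P.rot^[n] (b d.fst) = d := by
    intro d
    rcases P.eq_or_of_fst_eq (b d.fst) d (hb _).symm with h | h | h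
    · exact ⟨0, h.symm⟩
    · exact ⟨1, h.symm⟩
    · exact ⟨2, h.symm⟩
  choose n hn using hn
  -- `rot` acts freely with order 3, so the number of turns between two darts is determined modulo
  -- 3, and `ρ` sees no more than that.
  have hmod : ∀ (k l : ℕ) (d : P.graph.Dart), P.rot^[k] d = P.rot^[l] d → ρ ^ k = ρ ^ l := by
    have hd1 := P.rot_ne
    have hd2 : ∀ d, P.rot (P.rot d) ≠ d := fun d h => P.rot_ne d (by
      have := P.rot_rot_rot d
      rwa [h] at this)
    have h3 : P.rot^[3] = id := funext P.rot_rot_rot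
    have hred : ∀ k, P.rot^[k] = P.rot^[k % 3] := by
      intro k
      conv_lhs => rw [← Nat.div_add_mod k 3, add_comm, Function.iterate_add,
        Function.iterate_mul, h3, Function.iterate_id, Function.comp_id]
    intro k l d h
    rw [pow_eq_pow_mod k hρ, pow_eq_pow_mod l hρ]
    rw [hred k, hred l] at h
    have hk : k % 3 < 3 := Nat.mod_lt _ (by norm_num)
    have hl : l % 3 < 3 := Nat.mod_lt _ (by norm_num)
    have e2 : ∀ d, P.rot (P.rot d) ≠ P.rot d := fun d => P.rot_ne _
    generalize k % 3 = k' at *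
    generalize l % 3 = l' at *
    interval_cases k' <;> interval_cases l' <;> first
      | rfl
      | exact absurd h (hd1 d)
      | exact absurd h (hd2 d)
      | exact absurd h.symm (hd1 d)
      | exact absurd h.symm (hd2 d)
      | exact absurd h (e2 d)
      | exact absurd h.symm (e2 d)
  have hσ' : σ⁻¹ = σ := inv_eq_of_mul_eq_one_left hσ
  -- The section `f` records the value at the base dart of each vertex. Transport along `d` turns
  -- from the base dart to `d`, reverses, and turns back to the base dart at the other end.
  let τ : P.graph.Dart → Equiv.Perm X := fun d => (ρ ^ n d.symm)⁻¹ * σ * ρ ^ n d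
  obtain ⟨f, hf₀, hf⟩ := P.isTree.exists_parallel_section τ
    (fun d => by simp [τ, mul_inv_rev, hσ', mul_assoc]) d₀.fst ((ρ ^ n d₀)⁻¹ x₀)
  refine ⟨fun d => (ρ ^ n d) (f d.fst), by simp [hf₀], fun d => ?_, fun d => ?_⟩
  · have h := hmod (n (P.rot d)) (n d + 1) (b d.fst) (by
      rw [Function.iterate_succ_apply', hn d]
      conv_rhs => rw [← hn (P.rot d), P.rot_fst])
    simp only [P.rot_fst, h, pow_succ', Equiv.Perm.mul_apply]
  · change (ρ ^ n d.symm) (f d.snd) = _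
    simp [hf d, τ]

theorem equivariant_ext {X : Type*} (σ ρ : X → X) {F G : P.graph.Dart → X} (d₀ : P.graph.Dart)
    (h₀ : F d₀ = G d₀) (hFr : ∀ d, F (P.rot d) = ρ (F d))
    (hFs : ∀ d : P.graph.Dart, F d.symm = σ (F d)) (hGr : ∀ d, G (P.rot d) = ρ (G d))
    (hGs : ∀ d : P.graph.Dart, G d.symm = σ (G d)) : F = G :=
  funext <| P.dart_induction d₀ h₀ (fun d h => by rw [hFr, hGr, h])
    (fun d h => by rw [hFs, hGs, h])

theorem symm_mul_symm (G : SimpleGraph V) :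
    (SimpleGraph.Dart.symm_involutive (G := G)).toPerm *
      (SimpleGraph.Dart.symm_involutive (G := G)).toPerm = 1 :=
  Equiv.ext fun d => d.symm_symm

/-- The permutation of the darts turning every dart to the next one around its initial vertex. -/
def rotPerm : Equiv.Perm P.graph.Dart :=
  ⟨P.rot, fun d => P.rot (P.rot d), P.rot_rot_rot, P.rot_rot_rot⟩

theorem rotPerm_pow_three : P.rotPerm ^ 3 = 1 := Equiv.ext P.rot_rot_rot

/-- The automorphisms of the oriented tree act transitively on the darts. -/
theorem exists_iso_mapDart (d d' : P.graph.Dart) :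
    ∃ φ : P.graph ≃g P.graph, φ.toHom.mapDart d = d' ∧
      ∀ x, φ.toHom.mapDart (P.rot x) = P.rot (φ.toHom.mapDart x) := by
  obtain ⟨F, hF, hFr, hFs⟩ := P.exists_equivariant (SimpleGraph.Dart.symm_involutive).toPerm
    P.rotPerm (symm_mul_symm _) P.rotPerm_pow_three d d'
  obtain ⟨G, hG, hGr, hGs⟩ := P.exists_equivariant (SimpleGraph.Dart.symm_involutive).toPerm
    P.rotPerm (symm_mul_symm _) P.rotPerm_pow_three d' d
  change ∀ x, F (P.rot x) = P.rot (F x) at hFr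
  change ∀ x, G (P.rot x) = P.rot (G x) at hGr
  change ∀ x, F x.symm = (F x).symm at hFs
  change ∀ x, G x.symm = (G x).symm at hGs
  -- Both composites fix a dart and commute with `rot` and `symm`, so by uniqueness they are the
  -- identity.
  have hGF : ∀ x, G (F x) = x := congrFun <| P.equivariant_ext SimpleGraph.Dart.symm P.rot
    (F := fun x => G (F x)) (G := fun x => x) d (by rw [hF, hG]) (fun x => by rw [hFr, hGr])
    (fun x => by rw [hFs, hGs]) (fun _ => rfl) (fun _ => rfl)
  have hFG : ∀ x, F (G x) = x := congrFun <| P.equivariant_ext SimpleGraph.Dart.symm P.rot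
    (F := fun x => F (G x)) (G := fun x => x) d' (by rw [hG, hF]) (fun x => by rw [hGr, hFr])
    (fun x => by rw [hGs, hFs]) (fun _ => rfl) (fun _ => rfl)
  choose b hb using P.exists_dart
  -- The induced map on vertices does not depend on the base dart used to define it.
  have hfst : ∀ (H : P.graph.Dart → P.graph.Dart), (∀ x, H (P.rot x) = P.rot (H x)) →
      ∀ x, (H (b x.fst)).fst = (H x).fst := by
    intro H hH x
    rcases P.eq_or_of_fst_eq (b x.fst) x (hb _).symm with h | h | h
    · rw [← h]
    · conv_rhs => rw [h, hH, P.rot_fst]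
    · conv_rhs => rw [h, hH, hH, P.rot_fst, P.rot_fst]
  have hsnd : ∀ (H : P.graph.Dart → P.graph.Dart), (∀ x, H (P.rot x) = P.rot (H x)) →
      (∀ x, H x.symm = (H x).symm) → ∀ x, (H (b x.snd)).fst = (H x).snd := by
    intro H hH hs x
    rw [show x.snd = x.symm.fst from rfl, hfst H hH, hs]
    rfl
  have hinv : ∀ (H K : P.graph.Dart → P.graph.Dart), (∀ x, K (P.rot x) = P.rot (K x)) →
      (∀ x, K (H x) = x) → ∀ v, (K (b (H (b v)).fst)).fst = v := by
    intro H K hK hKH v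
    rw [hfst K hK, hKH, hb]
  have hadj : ∀ (H : P.graph.Dart → P.graph.Dart), (∀ x, H (P.rot x) = P.rot (H x)) →
      (∀ x, H x.symm = (H x).symm) → ∀ {v w}, P.graph.Adj v w →
      P.graph.Adj (H (b v)).fst (H (b w)).fst := by
    intro H hH hs v w h
    have h1 := hfst H hH ⟨(v, w), h⟩
    have h2 := hsnd H hH hs ⟨(v, w), h⟩
    change (H (b v)).fst = _ at h1
    change (H (b w)).fst = _ at h2
    rw [h1, h2]
    exact (H _).adj
  let φ : P.graph ≃g P.graph :=
    { toFun := fun v => (F (b v)).fst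
      invFun := fun v => (G (b v)).fst
      left_inv := hinv F G hGr hGF
      right_inv := hinv G F hFr hFG
      map_rel_iff' := by
        intro v w
        refine ⟨fun h => ?_, fun h => hadj F hFr hFs h⟩
        have := hadj G hGr hGs h
        simpa only [Equiv.coe_fn_mk, hinv F G hGr hGF] using this }
  have hφ : ∀ x, φ.toHom.mapDart x = F x := fun x =>
    SimpleGraph.Dart.ext _ _ (Prod.ext (hfst F hFr x) (hsnd F hFr hFs x))
  exact ⟨φ, by rw [hφ, hF], fun x => by rw [hφ, hφ, hFr]⟩

end PlaneCubicTree

/-! ### The function artanh and the summand of the series -/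

theorem Real.artanh_div {s e : ℝ} (hs : 0 ≤ s) (h : s < e) :
    Real.artanh (s / e) = Real.log ((e + s) / (e - s)) / 2 := by
  have he : 0 < e := hs.trans_lt h
  have h0 : 0 ≤ s / e := by positivity
  have h1 : s / e < 1 := (div_lt_one he).2 h
  rw [Real.artanh_eq_half_log ⟨by linarith, h1.le⟩]
  have h2 : e - s ≠ 0 := by linarith
  have : (1 + s / e) / (1 - s / e) = (e + s) / (e - s) := by
    have h3 : 1 - s / e ≠ 0 := by linarith
    rw [div_eq_div_iff h3 h2]
    field_simp
  rw [this]
  ring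

/-- The remainder of order three in the power series of `artanh`. -/
noncomputable def artanhTail (z : ℝ) : ℝ := Real.artanh z - z - z ^ 3 / 3

/-- The remaining series has terms z^(2k+5)/(2k+5), each at most z^(4+k). Fourth order is all that
convergence needs. -/
theorem abs_artanhTail_le {z : ℝ} (h0 : 0 ≤ z) (h1 : z < 1) :
    |artanhTail z| ≤ z ^ 4 / (1 - z) := by
  have habs : |z| < 1 := by rwa [abs_of_nonneg h0]
  have hs := Real.hasSum_log_sub_log_of_abs_lt_one habs
  have hlog : Real.log (1 + z) - Real.log (1 - z) = 2 * Real.artanh z := by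
    rw [Real.artanh_eq_half_log ⟨by linarith, h1.le⟩,
      Real.log_div (by linarith) (by linarith)]
    ring
  rw [hlog] at hs
  have hs2 := ((hasSum_nat_add_iff' 2).2 hs).mul_left (1 / 2)
  have hval : 1 / 2 * (2 * Real.artanh z -
      ∑ k ∈ Finset.range 2, (2 : ℝ) * (1 / (2 * k + 1)) * z ^ (2 * k + 1)) = artanhTail z := by
    simp only [Finset.sum_range_succ, Finset.sum_range_zero, artanhTail]
    push_cast
    ring
  rw [hval] at hs2
  have hg := (hasSum_geometric_of_lt_one h0 h1).mul_left (z ^ 4)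
  have hnonneg : 0 ≤ artanhTail z := hs2.nonneg fun k => by positivity
  rw [abs_of_nonneg hnonneg, div_eq_mul_inv]
  refine hasSum_le (fun k => ?_) hs2 hg
  have hk : (1 : ℝ) / (2 * ((k + 2 : ℕ) : ℝ) + 1) ≤ 1 := by
    rw [div_le_one (by positivity)]
    linarith [(Nat.cast_nonneg (k + 2) : (0 : ℝ) ≤ ((k + 2 : ℕ) : ℝ))]
  have hpow : z ^ (2 * (k + 2) + 1) ≤ z ^ (4 + k) :=
    pow_le_pow_of_le_one h0 h1.le (by omega)
  calc 1 / 2 * (2 * (1 / (2 * ((k + 2 : ℕ) : ℝ) + 1)) * z ^ (2 * (k + 2) + 1))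
      = 1 / (2 * ((k + 2 : ℕ) : ℝ) + 1) * z ^ (2 * (k + 2) + 1) := by ring
    _ ≤ 1 * z ^ (4 + k) := by gcongr
    _ = z ^ 4 * z ^ k := by ring

/-- After exponentiation this is (E+s)(f-s)(g-s) = (E-s)(f+s)(g+s), whose two sides differ by 2s
times the discriminant relation `h`. -/
theorem artanh_div_eq_add {s E f g : ℝ} (hs : 0 ≤ s) (hE : s < E) (hf : s < f) (hg : s < g)
    (h : E * f + E * g - f * g = s ^ 2) :
    Real.artanh (s / E) = Real.artanh (s / f) + Real.artanh (s / g) := by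
  rw [Real.artanh_div hs hE, Real.artanh_div hs hf, Real.artanh_div hs hg, ← add_div,
    ← Real.log_mul (div_pos (by linarith) (by linarith)).ne'
      (div_pos (by linarith) (by linarith)).ne']
  congr 2
  have h1 : E - s ≠ 0 := by linarith
  have h2 : f - s ≠ 0 := by linarith
  have h3 : g - s ≠ 0 := by linarith
  rw [div_mul_div_comm, div_eq_div_iff h1 (mul_ne_zero h2 h3)]
  linear_combination (-2 * s) * h

/-- The summand of the series as a function of the three labels at a vertex. -/
noncomputable def edgeSummand (D e f g : ℝ) : ℝ :=
  D ^ (5 / 2 : ℝ) * |e + f + g| / |e * f * g| ^ 2 + D ^ (9 / 2 : ℝ) / (3 * |e * f * g| ^ 3)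

theorem edgeSummand_rot (D e f g : ℝ) : edgeSummand D f g e = edgeSummand D e f g := by
  rw [edgeSummand, edgeSummand, show f + g + e = e + f + g by ring,
    show f * g * e = e * f * g by ring]

theorem edgeSummand_neg (D e f g : ℝ) : edgeSummand D (-e) (-f) (-g) = edgeSummand D e f g := by
  rw [edgeSummand, edgeSummand, show -e + -f + -g = -(e + f + g) by ring,
    show -e * -f * -g = -(e * f * g) by ring, abs_neg, abs_neg]

theorem edgeSummand_sq {s : ℝ} (hs : 0 ≤ s) (e f g : ℝ) :
    edgeSummand (s ^ 2) e f g =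
      s ^ 5 * |e + f + g| / |e * f * g| ^ 2 + s ^ 9 / (3 * |e * f * g| ^ 3) := by
  have h : ∀ n : ℕ, (s ^ 2) ^ ((n : ℝ) / 2) = s ^ n := by
    intro n
    rw [← Real.rpow_natCast s 2, ← Real.rpow_mul hs, ← Real.rpow_natCast s n]
    congr 1
    push_cast
    ring
  have h5 := h 5
  have h9 := h 9
  norm_num at h5 h9
  rw [edgeSummand, h5, h9]

/-- The artanh terms cancel by additivity. With x = s/E, y = s/f, z = s/g, the relation `h` says
that the first elementary symmetric function of -x, y, z is P = xyz, while the third is -P. Newton's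
identity p₃ = e₁³ - 3e₁e₂ + 3e₃ turns the remaining p₁ + p₃/3 into P³/3 - P e₂, which are the two
fractions of the summand. -/
theorem edgeSummand_eq_artanhTail {s E f g : ℝ} (hs : 0 < s) (hE : s < E) (hf : s < f)
    (hg : s < g) (h : E * f + E * g - f * g = s ^ 2) (hsum : E ≤ f + g) :
    edgeSummand (s ^ 2) (-E) f g =
      artanhTail (s / E) - artanhTail (s / f) - artanhTail (s / g) := by
  have hE0 : 0 < E := hs.trans hE
  have hf0 : 0 < f := hs.trans hf
  have hg0 : 0 < g := hs.trans hg
  rw [edgeSummand_sq hs.le, artanhTail, artanhTail, artanhTail, artanh_div_eq_add hs.le hE hf hg h,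
    abs_of_nonneg (show 0 ≤ -E + f + g by linarith),
    show -E * f * g = -(E * f * g) by ring, abs_neg, abs_of_pos (by positivity)]
  have key : s ^ 5 * (-E + f + g) / (E * f * g) ^ 2 + s ^ 9 / (3 * (E * f * g) ^ 3) =
      -(s / E) - (s / E) ^ 3 / 3 + s / f + (s / f) ^ 3 / 3 + s / g + (s / g) ^ 3 / 3 := by
    have hE' : s / E * (E * f * g) = s * (f * g) := by field_simp
    have h1 : s / f + s / g - s / E = s ^ 3 / (E * f * g) := by
      field_simp
      linear_combination h
    have h2 : s / f * (s / g) - s / E * (s / f) - s / E * (s / g) =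
        s ^ 2 * (E - f - g) / (E * f * g) := by
      field_simp
      ring
    have h3 : s / E * (s / f) * (s / g) = s ^ 3 / (E * f * g) := by
      field_simp
    have h4 : s ^ 5 * (-E + f + g) / (E * f * g) ^ 2 =
        -(s ^ 3 / (E * f * g) * (s ^ 2 * (E - f - g) / (E * f * g))) := by
      field_simp
      ring
    have h5 : s ^ 9 / (3 * (E * f * g) ^ 3) = (s ^ 3 / (E * f * g)) ^ 3 / 3 := by
      field_simp
    rw [h4, h5]
    generalize s ^ 3 / (E * f * g) = P at *
    generalize s ^ 2 * (E - f - g) / (E * f * g) = Q at *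
    generalize s / E = x at *
    generalize s / f = y at *
    generalize s / g = z at *
    subst h2
    have hx : x = y + z - P := by linarith
    have h6 : P - x * y * z = 0 := by linarith
    subst hx
    linear_combination -h6
  rw [key]
  ring

/-- The two river labels cancel in the sum of the labels, and what is left are exactly the terms
subtracted in `artanhTail`. This is the purpose of relabelling the river by √D. -/
theorem edgeSummand_river {s g : ℝ} (hs : 0 < s) (hg : s < |g|) :
    edgeSummand (s ^ 2) s (-s) g = s / |g| + (s / |g|) ^ 3 / 3 := by
  have hg0 : 0 < |g| := hs.trans hg
  rw [edgeSummand_sq hs.le, show s + -s + g = g by ring, show s * -s * g = -(s * s * g) by ring,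
    abs_neg, abs_mul, abs_of_pos (mul_pos hs hs)]
  field_simp

/-! ### Flags: the labels around a directed edge -/

/-- The labels of the regions on the left, on the right, and at the initial end of a directed edge
of a topograph. -/
@[ext]
structure EdgeFlag where
  left : ℤ
  right : ℤ
  back : ℤ

namespace EdgeFlag

/-- The label of the region at the final end. -/
def front (x : EdgeFlag) : ℤ := 2 * (x.left + x.right) - x.back

/-- The edge label. -/
def edge (x : EdgeFlag) : ℤ := x.left + x.right - x.back

/-- The next edge around the initial vertex. -/
def rot (x : EdgeFlag) : EdgeFlag := ⟨x.back, x.left, x.right⟩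

/-- The reversed edge. -/
def symm (x : EdgeFlag) : EdgeFlag := ⟨x.right, x.left, x.front⟩

/-- The edge on the left at the final vertex. -/
def turnLeft (x : EdgeFlag) : EdgeFlag := ⟨x.left, x.front, x.right⟩

/-- The edge on the right at the final vertex. -/
def turnRight (x : EdgeFlag) : EdgeFlag := ⟨x.front, x.right, x.left⟩

/-- The discriminant of a flag. -/
def disc (x : EdgeFlag) : ℤ := x.edge ^ 2 - 4 * (x.left * x.right)

/-- Rightward river edges. -/
def IsRiver (x : EdgeFlag) : Prop := 0 < x.left ∧ x.right < 0

/-- Edges off the river, directed away from it. -/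
def IsClimbing (x : EdgeFlag) : Prop :=
  (0 < x.left ∧ 0 < x.right ∧ 0 < x.edge) ∨ (x.left < 0 ∧ x.right < 0 ∧ x.edge < 0)

/-- Edges leaving the river. -/
def IsRoot (x : EdgeFlag) : Prop :=
  (0 < x.left ∧ 0 < x.right ∧ x.back < 0) ∨ (x.left < 0 ∧ x.right < 0 ∧ 0 < x.back)

/-- The edge that leaves the river at the final vertex of a rightward river edge. -/
def exit (x : EdgeFlag) : EdgeFlag := if 0 < x.front then x.turnLeft else x.turnRight

/-- The rightward river edge following a given one. -/
def next (x : EdgeFlag) : EdgeFlag := if 0 < x.front then x.turnRight else x.turnLeft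

theorem rot_symm (x : EdgeFlag) : x.symm.rot = x.turnRight := rfl

theorem rot_rot_symm (x : EdgeFlag) : x.symm.rot.rot = x.turnLeft := rfl

theorem rot_rot_rot (x : EdgeFlag) : x.rot.rot.rot = x := rfl

theorem front_symm (x : EdgeFlag) : x.symm.front = x.back := by simp only [front, symm]; ring

theorem symm_symm (x : EdgeFlag) : x.symm.symm = x := by
  ext <;> simp only [symm, front]; ring

theorem disc_rot (x : EdgeFlag) : x.rot.disc = x.disc := by simp only [disc, rot, edge]; ring

theorem disc_symm (x : EdgeFlag) : x.symm.disc = x.disc := by simp only [disc, symm, edge, front]; ring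

theorem disc_turnLeft (x : EdgeFlag) : x.turnLeft.disc = x.disc := by
  rw [← rot_rot_symm, disc_rot, disc_rot, disc_symm]

theorem disc_turnRight (x : EdgeFlag) : x.turnRight.disc = x.disc := by
  rw [← rot_symm, disc_rot, disc_symm]

theorem edge_symm (x : EdgeFlag) : x.symm.edge = -x.edge := by simp only [edge, symm, front]; ring

theorem edge_turnLeft (x : EdgeFlag) : x.turnLeft.edge = x.edge + 2 * x.left := by
  simp only [edge, turnLeft, front]; ring

theorem edge_turnRight (x : EdgeFlag) : x.turnRight.edge = x.edge + 2 * x.right := by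
  simp only [edge, turnRight, front]; ring

theorem front_eq (x : EdgeFlag) : x.front = x.left + x.right + x.edge := by
  simp only [edge, front]; ring

theorem back_eq (x : EdgeFlag) : x.back = x.left + x.right - x.edge := by
  simp only [edge]; ring

theorem left_ne_zero {x : EdgeFlag} (h : ¬ IsSquare x.disc) : x.left ≠ 0 := fun h0 =>
  h ⟨x.edge, by rw [disc, h0]; ring⟩

theorem right_ne_zero {x : EdgeFlag} (h : ¬ IsSquare x.disc) : x.right ≠ 0 := fun h0 =>
  h ⟨x.edge, by rw [disc, h0]; ring⟩

theorem back_ne_zero {x : EdgeFlag} (h : ¬ IsSquare x.disc) : x.back ≠ 0 :=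
  left_ne_zero (x := x.rot) (by rwa [disc_rot])

theorem front_ne_zero {x : EdgeFlag} (h : ¬ IsSquare x.disc) : x.front ≠ 0 :=
  back_ne_zero (x := x.symm) (by rwa [disc_symm])

/-- `turnLeft` as a permutation. -/
def turnLeftEquiv : EdgeFlag ≃ EdgeFlag where
  toFun := turnLeft
  invFun x := x.rot.symm
  left_inv x := by ext <;> simp only [turnLeft, rot, symm, front]; ring
  right_inv x := by ext <;> simp only [turnLeft, rot, symm, front]; ring

/-- `turnRight` as a permutation. -/
def turnRightEquiv : EdgeFlag ≃ EdgeFlag where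
  toFun := turnRight
  invFun x := x.rot.rot.symm
  left_inv x := by ext <;> simp only [turnRight, rot, symm, front]; ring
  right_inv x := by ext <;> simp only [turnRight, rot, symm, front]; ring

theorem not_isRiver_of_isClimbing {x : EdgeFlag} (h : x.IsClimbing) : ¬ x.IsRiver := by
  rintro ⟨h1, h2⟩
  rcases h with h | h <;> omega

theorem isClimbing_of_isRoot {x : EdgeFlag} (h : x.IsRoot) : x.IsClimbing := by
  rcases h with ⟨h1, h2, h3⟩ | ⟨h1, h2, h3⟩
  · exact Or.inl ⟨h1, h2, by simp only [edge]; omega⟩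
  · exact Or.inr ⟨h1, h2, by simp only [edge]; omega⟩

/-- Conway's climbing lemma: the new region label and the increment of the edge label have the sign
of the old sides. -/
theorem IsClimbing.turnLeft {x : EdgeFlag} (h : x.IsClimbing) : x.turnLeft.IsClimbing := by
  simp only [IsClimbing, edge, EdgeFlag.turnLeft, front] at *
  omega

theorem IsClimbing.turnRight {x : EdgeFlag} (h : x.IsClimbing) : x.turnRight.IsClimbing := by
  simp only [IsClimbing, edge, EdgeFlag.turnRight, front] at *
  omega

theorem IsRiver.next {x : EdgeFlag} (h : x.IsRiver) (hf : x.front ≠ 0) : x.next.IsRiver := by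
  obtain ⟨h1, h2⟩ := h
  unfold EdgeFlag.next
  split_ifs with h3
  · exact ⟨h3, h2⟩
  · exact ⟨h1, by simp only [EdgeFlag.turnLeft]; omega⟩

theorem IsRiver.isRoot_exit {x : EdgeFlag} (h : x.IsRiver) (hf : x.front ≠ 0) : x.exit.IsRoot := by
  obtain ⟨h1, h2⟩ := h
  unfold exit
  split_ifs with h3
  · exact Or.inl ⟨h1, h3, h2⟩
  · exact Or.inr ⟨by simp only [EdgeFlag.turnRight]; omega, h2, h1⟩

/-- Otherwise |edge| is at most twice the absolute value of either side, so edge² ≤ 4·left·right and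
the discriminant is not positive. This excludes a local minimum of the labels away from the river.
-/
theorem lt_or_lt_of_disc_pos {x : EdgeFlag} (h : 0 < x.disc) :
    (0 < x.left → 0 < x.right → 0 < x.edge →
      x.left + x.back < x.right ∨ x.right + x.back < x.left) ∧
    (x.left < 0 → x.right < 0 → x.edge < 0 →
      x.right < x.left + x.back ∨ x.left < x.right + x.back) := by
  rw [disc] at h
  have hb := x.back_eq
  refine ⟨fun h1 h2 h3 => ?_, fun h1 h2 h3 => ?_⟩ <;> by_contra! hc
  · have h4 : x.edge ≤ 2 * x.left := by omega
    have h5 : x.edge ≤ 2 * x.right := by omega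
    nlinarith [mul_le_mul h4 h5 h3.le (by omega)]
  · have h4 : -x.edge ≤ 2 * -x.left := by omega
    have h5 : -x.edge ≤ 2 * -x.right := by omega
    nlinarith [mul_le_mul h4 h5 (by omega) (by omega)]

/-- A set of flags closed under passing to adjacent directed edges. -/
structure Closed (S : Set EdgeFlag) : Prop where
  rot : ∀ x ∈ S, x.rot ∈ S
  symm : ∀ x ∈ S, x.symm ∈ S

namespace Closed

variable {S : Set EdgeFlag}

theorem turnLeft (h : Closed S) {x : EdgeFlag} (hx : x ∈ S) : x.turnLeft ∈ S :=
  h.rot _ (h.rot _ (h.symm _ hx))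

theorem turnRight (h : Closed S) {x : EdgeFlag} (hx : x ∈ S) : x.turnRight ∈ S :=
  h.rot _ (h.symm _ hx)

theorem exit (h : Closed S) {x : EdgeFlag} (hx : x ∈ S) : x.exit ∈ S := by
  unfold EdgeFlag.exit
  split_ifs
  exacts [h.turnLeft hx, h.turnRight hx]

theorem next (h : Closed S) {x : EdgeFlag} (hx : x ∈ S) : x.next ∈ S := by
  unfold EdgeFlag.next
  split_ifs
  exacts [h.turnRight hx, h.turnLeft hx]

/-- The common sign of its two sides tells whether an edge left the river by a left or a right turn,
and undoing that turn recovers the river edge. -/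
theorem bijOn_exit (h : Closed S) (hsq : ∀ x ∈ S, ¬ IsSquare x.disc) :
    Set.BijOn EdgeFlag.exit (S ∩ {x | x.IsRiver}) (S ∩ {x | x.IsRoot}) := by
  refine ⟨fun x hx => ⟨h.exit hx.1, hx.2.isRoot_exit (front_ne_zero (hsq x hx.1))⟩, ?_, ?_⟩
  · rintro x ⟨-, h1, h2⟩ y ⟨-, h3, h4⟩ hxy
    simp only [EdgeFlag.exit] at hxy
    split_ifs at hxy with h5 h6 h6
    · exact turnLeftEquiv.injective hxy
    · have := congrArg EdgeFlag.left hxy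
      simp only [EdgeFlag.turnLeft, EdgeFlag.turnRight] at this
      omega
    · have := congrArg EdgeFlag.left hxy
      simp only [EdgeFlag.turnLeft, EdgeFlag.turnRight] at this
      omega
    · exact turnRightEquiv.injective hxy
  · rintro y ⟨hy, hr⟩
    rcases hr with ⟨h1, h2, h3⟩ | ⟨h1, h2, h3⟩
    · have hR : y.rot.symm.turnLeft = y := turnLeftEquiv.right_inv y
      have hf : 0 < y.rot.symm.front := by rw [front_symm]; exact h2
      exact ⟨y.rot.symm, ⟨h.symm _ (h.rot _ hy), h1, h3⟩, by rw [EdgeFlag.exit, if_pos hf, hR]⟩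
    · have hR : y.rot.rot.symm.turnRight = y := turnRightEquiv.right_inv y
      have hf : ¬ 0 < y.rot.rot.symm.front := by rw [front_symm]; exact h1.not_gt
      exact ⟨y.rot.rot.symm, ⟨h.symm _ (h.rot _ (h.rot _ hy)), h3, h2⟩,
        by rw [EdgeFlag.exit, if_neg hf, hR]⟩

/-- Every edge leading away from the river either starts on the river or continues exactly one
other such edge. -/
theorem indicator_isClimbing (h : Closed S) (hsq : ∀ x ∈ S, ¬ IsSquare x.disc)
    (hpos : ∀ x ∈ S, 0 < x.disc) (f : EdgeFlag → ℝ) :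
    (S ∩ {x | x.IsClimbing}).indicator f =
      (EdgeFlag.turnLeft '' (S ∩ {x | x.IsClimbing})).indicator f +
      (EdgeFlag.turnRight '' (S ∩ {x | x.IsClimbing})).indicator f +
      (S ∩ {x | x.IsRoot}).indicator f := by
  classical
  -- Turns are invertible, so being a child becomes a condition on the two other edges arriving at
  -- the initial vertex of `y`.
  have hL : ∀ y : EdgeFlag, y ∈ EdgeFlag.turnLeft '' (S ∩ {x | x.IsClimbing}) ↔
      y ∈ S ∧ y.rot.symm.IsClimbing := by
    intro y
    constructor
    · rintro ⟨x, ⟨hx, hc⟩, rfl⟩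
      exact ⟨h.turnLeft hx, by rwa [show x.turnLeft.rot.symm = x from turnLeftEquiv.left_inv x]⟩
    · rintro ⟨hy, hc⟩
      exact ⟨_, ⟨h.symm _ (h.rot _ hy), hc⟩, turnLeftEquiv.right_inv y⟩
  have hR : ∀ y : EdgeFlag, y ∈ EdgeFlag.turnRight '' (S ∩ {x | x.IsClimbing}) ↔
      y ∈ S ∧ y.rot.rot.symm.IsClimbing := by
    intro y
    constructor
    · rintro ⟨x, ⟨hx, hc⟩, rfl⟩
      exact ⟨h.turnRight hx,
        by rwa [show x.turnRight.rot.rot.symm = x from turnRightEquiv.left_inv x]⟩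
    · rintro ⟨hy, hc⟩
      exact ⟨_, ⟨h.symm _ (h.rot _ (h.rot _ hy)), hc⟩, turnRightEquiv.right_inv y⟩
  ext y
  simp only [Pi.add_apply, Set.indicator_apply, hL, hR, Set.mem_inter_iff, Set.mem_ofPred_eq]
  by_cases hy : y ∈ S
  · have hb := back_ne_zero (hsq y hy)
    have hd := hpos y hy
    -- If the label behind a climbing `y` has the opposite sign, `y` is a root. Otherwise positivity
    -- of the discriminant makes exactly one of the two predecessors climb.
    have hcase : (y.IsClimbing ∧ y.rot.symm.IsClimbing ∧ ¬ y.rot.rot.symm.IsClimbing ∧ ¬ y.IsRoot) ∨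
        (y.IsClimbing ∧ ¬ y.rot.symm.IsClimbing ∧ y.rot.rot.symm.IsClimbing ∧ ¬ y.IsRoot) ∨
        (y.IsClimbing ∧ ¬ y.rot.symm.IsClimbing ∧ ¬ y.rot.rot.symm.IsClimbing ∧ y.IsRoot) ∨
        (¬ y.IsClimbing ∧ ¬ y.rot.symm.IsClimbing ∧ ¬ y.rot.rot.symm.IsClimbing ∧ ¬ y.IsRoot) := by
      have h1 := lt_or_lt_of_disc_pos hd
      simp only [edge, IsClimbing, IsRoot, EdgeFlag.rot, EdgeFlag.symm, front] at *
      omega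
    rcases hcase with ⟨h1, h2, h3, h4⟩ | ⟨h1, h2, h3, h4⟩ | ⟨h1, h2, h3, h4⟩ | ⟨h1, h2, h3, h4⟩ <;>
      simp [hy, h1, h2, h3, h4]
  · simp [hy]

end Closed

end EdgeFlag

/-! ### Convergence and telescoping -/

/-- Here `P` stands for the product of the two sides. Then (√D/E)⁴ ≤ (D/4P)², while P ≥ 1 keeps √D/E
away from 1. -/
theorem abs_artanhTail_sqrt_div_le {D P E : ℝ} (hD : 0 < D) (hP : 1 ≤ P) (hE : 0 < E)
    (h : E ^ 2 = D + 4 * P) :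
    |artanhTail (√D / E)| ≤ D ^ 2 / 16 / (1 - √(D / (D + 4))) * (1 / P ^ 2) := by
  have hz0 : 0 ≤ √D / E := by positivity
  have hz2 : (√D / E) ^ 2 = D / (D + 4 * P) := by rw [div_pow, Real.sq_sqrt hD.le, h]
  have hle : √D / E ≤ √(D / (D + 4)) := by
    apply Real.le_sqrt_of_sq_le
    rw [hz2]
    gcongr
    linarith
  have hlt : √(D / (D + 4)) < 1 := by
    rw [Real.sqrt_lt' one_pos, one_pow, div_lt_one (by positivity)]
    linarith
  have h4 : (√D / E) ^ 4 ≤ D ^ 2 / 16 * (1 / P ^ 2) := by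
    have h5 : (√D / E) ^ 4 = (D / (D + 4 * P)) ^ 2 := by rw [← hz2]; ring
    have h6 : D ^ 2 / 16 * (1 / P ^ 2) = (D / (4 * P)) ^ 2 := by
      field_simp
      ring
    rw [h5, h6]
    gcongr
    linarith
  have h1 : 0 < 1 - √(D / (D + 4)) := by linarith
  calc |artanhTail (√D / E)| ≤ (√D / E) ^ 4 / (1 - √D / E) :=
        abs_artanhTail_le hz0 (hle.trans_lt hlt)
    _ ≤ (D ^ 2 / 16 * (1 / P ^ 2)) / (1 - √(D / (D + 4))) := by gcongr
    _ = _ := by ring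

theorem hasSum_indicator_of_finite {α : Type*} {A : Set α} (hA : A.Finite) (f : α → ℝ) :
    HasSum (A.indicator f) (∑ᶠ x ∈ A, f x) := by
  have hs : (A.indicator f).HasFiniteSupport := hA.subset Set.support_indicator_subset
  rw [finsum_mem_def, ← tsum_eq_finsum (L := SummationFilter.unconditional _) hs]
  exact (summable_of_hasFiniteSupport hs).hasSum

namespace EdgeFlag

open Classical in
/-- The edge label, modified on the river. -/
noncomputable def star (D : ℤ) (x : EdgeFlag) : ℝ :=
  if x.IsRiver then √D else if x.symm.IsRiver then -√D else (x.edge : ℝ)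

/-- The summand at the final vertex. -/
noncomputable def frontTerm (D : ℤ) (x : EdgeFlag) : ℝ :=
  edgeSummand D (star D x.symm) (star D x.turnRight) (star D x.turnLeft)

/-- The remainder of `artanh (√D / |e|)`, for an edge label `e`. -/
noncomputable def tail (D : ℤ) (x : EdgeFlag) : ℝ := artanhTail (√D / |(x.edge : ℝ)|)

theorem star_of_mul_pos {D : ℤ} {x : EdgeFlag} (h : 0 < x.left * x.right) :
    star D x = x.edge := by
  rcases mul_pos_iff.1 h with ⟨h1, h2⟩ | ⟨h1, h2⟩
  · rw [star, if_neg (fun h => h2.not_gt h.2), if_neg (fun h => h1.not_gt h.2)]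
  · rw [star, if_neg (fun h => h1.not_gt h.1), if_neg (fun h => h2.not_gt h.1)]

theorem star_of_isRiver {D : ℤ} {x : EdgeFlag} (h : x.IsRiver) : star D x = √D := if_pos h

theorem star_symm_of_isRiver {D : ℤ} {x : EdgeFlag} (h : x.IsRiver) : star D x.symm = -√D := by
  rw [star, if_neg (fun h' => h.1.not_gt h'.2), if_pos (by rwa [symm_symm])]

theorem sqrt_lt_of_disc {D : ℤ} {x : EdgeFlag} (hD₀ : 0 ≤ D) (hD : x.disc = D) (h : 0 < x.left * x.right) :
    √(D : ℝ) < |(x.edge : ℝ)| := by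
  rw [← Real.sqrt_sq_eq_abs]
  have h2 : D < x.edge ^ 2 := by rw [← hD, disc]; linarith
  have h3 : (D : ℝ) < (x.edge : ℝ) ^ 2 := by exact_mod_cast h2
  exact Real.sqrt_lt_sqrt (by exact_mod_cast hD₀) h3

theorem IsClimbing.mul_pos {x : EdgeFlag} (h : x.IsClimbing) : 0 < x.left * x.right := by
  rcases h with ⟨h1, h2, -⟩ | ⟨h1, h2, -⟩
  exacts [_root_.mul_pos h1 h2, mul_pos_of_neg_of_neg h1 h2]

/-- The labels leaving the final vertex are -e, e + 2·right and e + 2·left, and for these `disc` is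
the relation needed for additivity. Negative sides reduce to positive ones by changing all signs. -/
theorem frontTerm_of_isClimbing {D : ℤ} (hD : 0 < D) {x : EdgeFlag} (hx : x.disc = D)
    (h : x.IsClimbing) :
    frontTerm D x = tail D x - tail D x.turnLeft - tail D x.turnRight := by
  have hL := h.turnLeft
  have hR := h.turnRight
  have hs : 0 < √(D : ℝ) := Real.sqrt_pos.2 (by exact_mod_cast hD)
  have hs2 : (D : ℝ) = √(D : ℝ) ^ 2 := (Real.sq_sqrt (by exact_mod_cast hD.le)).symm
  have l0 := sqrt_lt_of_disc hD.le hx h.mul_pos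
  have l1 := sqrt_lt_of_disc hD.le (x.disc_turnLeft.trans hx) hL.mul_pos
  have l2 := sqrt_lt_of_disc hD.le (x.disc_turnRight.trans hx) hR.mul_pos
  have hid : (x.edge : ℝ) * x.turnRight.edge + x.edge * x.turnLeft.edge -
      x.turnRight.edge * x.turnLeft.edge = √(D : ℝ) ^ 2 := by
    rw [← hs2, ← hx, disc, edge_turnLeft, edge_turnRight]
    push_cast
    ring
  have hsum : x.turnRight.edge + x.turnLeft.edge - x.edge = x.left + x.right + x.front := by
    rw [edge_turnLeft, edge_turnRight, front_eq]
    ring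
  have hf := x.front_eq
  rw [frontTerm, star_of_mul_pos (x := x.symm) (by simpa [symm, mul_comm] using h.mul_pos),
    star_of_mul_pos hL.mul_pos, star_of_mul_pos hR.mul_pos, edge_symm, tail, tail, tail]
  push_cast
  rcases h with ⟨h1, h2, h3⟩ | ⟨h1, h2, h3⟩
  · have h4 : 0 < x.turnLeft.edge := by rw [edge_turnLeft]; omega
    have h5 : 0 < x.turnRight.edge := by rw [edge_turnRight]; omega
    have h6 : x.edge ≤ x.turnRight.edge + x.turnLeft.edge := by omega
    have c3 : (0 : ℝ) < x.edge := by exact_mod_cast h3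
    have c4 : (0 : ℝ) < x.turnLeft.edge := by exact_mod_cast h4
    have c5 : (0 : ℝ) < x.turnRight.edge := by exact_mod_cast h5
    rw [abs_of_pos c3] at l0 ⊢
    rw [abs_of_pos c4] at l1 ⊢
    rw [abs_of_pos c5] at l2 ⊢
    conv_lhs => rw [hs2]
    rw [edgeSummand_eq_artanhTail hs l0 l2 l1 hid (by exact_mod_cast h6)]
    ring
  · have h4 : x.turnLeft.edge < 0 := by rw [edge_turnLeft]; omega
    have h5 : x.turnRight.edge < 0 := by rw [edge_turnRight]; omega
    have h6 : -x.edge ≤ -x.turnRight.edge + -x.turnLeft.edge := by omega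
    have c3 : (x.edge : ℝ) < 0 := by exact_mod_cast h3
    have c4 : (x.turnLeft.edge : ℝ) < 0 := by exact_mod_cast h4
    have c5 : (x.turnRight.edge : ℝ) < 0 := by exact_mod_cast h5
    rw [abs_of_neg c3] at l0 ⊢
    rw [abs_of_neg c4] at l1 ⊢
    rw [abs_of_neg c5] at l2 ⊢
    conv_lhs => rw [hs2]
    rw [← edgeSummand_neg, edgeSummand_eq_artanhTail hs l0 l2 l1 (by linarith)
      (by exact_mod_cast h6)]
    ring

/-- The river term supplies the two Taylor terms missing from the tail of the exit edge. -/
theorem frontTerm_add_tail_exit {D : ℤ} (hD : 0 < D) {x : EdgeFlag} (hx : x.disc = D)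
    (hf : x.front ≠ 0) (h : x.IsRiver) :
    frontTerm D x + tail D x.exit = Real.artanh (√D / |(x.exit.edge : ℝ)|) := by
  have hs : 0 < √(D : ℝ) := Real.sqrt_pos.2 (by exact_mod_cast hD)
  have hs2 : (D : ℝ) = √(D : ℝ) ^ 2 := (Real.sq_sqrt (by exact_mod_cast hD.le)).symm
  have hmul := (isClimbing_of_isRoot (h.isRoot_exit hf)).mul_pos
  have hdisc : x.exit.disc = D := by
    unfold exit
    split_ifs
    exacts [x.disc_turnLeft.trans hx, x.disc_turnRight.trans hx]
  have hlt := sqrt_lt_of_disc hD.le hdisc hmul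
  have hn := h.next hf
  suffices frontTerm D x = √D / |(x.exit.edge : ℝ)| + (√D / |(x.exit.edge : ℝ)|) ^ 3 / 3 by
    rw [this, tail, artanhTail]
    ring
  rw [frontTerm, star_symm_of_isRiver h]
  unfold exit next at *
  split_ifs at * with h3
  · rw [star_of_isRiver hn, star_of_mul_pos hmul, ← edgeSummand_neg, neg_neg]
    simpa only [abs_neg, ← hs2] using edgeSummand_river hs (hlt.trans_eq (abs_neg _).symm)
  · rw [star_of_isRiver hn, star_of_mul_pos hmul, ← edgeSummand_rot, ← edgeSummand_rot]
    simpa only [← hs2] using edgeSummand_river hs hlt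

/-- On the river D is the sum of the nonnegative terms edge² and -4·left·right, which bounds all
three labels. -/
theorem finite_isRiver (D : ℤ) : {x : EdgeFlag | x.disc = D ∧ x.IsRiver}.Finite := by
  refine (((Set.finite_Icc (0 : ℤ) D).prod ((Set.finite_Icc (-D) 0).prod
    (Set.finite_Icc (-D) D))).image fun p => (⟨p.1, p.2.1, p.1 + p.2.1 - p.2.2⟩ : EdgeFlag)).subset ?_
  rintro x ⟨h, h1, h2⟩
  refine ⟨(x.left, x.right, x.edge), ?_, ?_⟩
  · rw [disc] at h
    have h3 : x.left ≤ x.left * -x.right := le_mul_of_one_le_right h1.le (by omega)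
    have h4 : -x.right ≤ x.left * -x.right := le_mul_of_one_le_left (by omega) h1
    have h5 := Int.le_self_sq x.edge
    have h6 := Int.le_self_sq (-x.edge)
    have h7 := sq_nonneg x.edge
    rw [neg_sq] at h6
    rw [mul_neg] at h3 h4
    simp only [Set.mem_prod, Set.mem_Icc]
    refine ⟨⟨?_, ?_⟩, ⟨?_, ?_⟩, ?_, ?_⟩ <;> linarith
  · ext
    · rfl
    · rfl
    · simp only [edge]; ring

namespace Closed

variable {S : Set EdgeFlag} {D : ℤ}

/-- For fixed D a climbing flag is determined by its two sides m, n, since they fix the edge label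
up to sign and climbing fixes the sign. The double series of 1/(m²n²) is therefore a majorant, up to
a constant. -/
theorem summable_tail (hD : 0 < D) (hS : ∀ x ∈ S, x.disc = D) :
    Summable ((S ∩ {x | x.IsClimbing}).indicator (tail D)) := by
  rw [← summable_subtype_iff_indicator]
  have hsum : Summable fun n : ℤ => 1 / (n : ℝ) ^ 2 := Real.summable_one_div_int_pow.2 one_lt_two
  have hprod : Summable fun p : ℤ × ℤ => 1 / (p.1 : ℝ) ^ 2 * (1 / (p.2 : ℝ) ^ 2) :=
    hsum.mul_of_nonneg hsum (fun n => by positivity) (fun n => by positivity)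
  have hinj : Function.Injective
      fun x : ↥(S ∩ {x : EdgeFlag | x.IsClimbing}) => (x.1.left, x.1.right) := by
    rintro ⟨x, hx, hxc⟩ ⟨y, hy, hyc⟩ hxy
    obtain ⟨h1, h2⟩ : x.left = y.left ∧ x.right = y.right := by simpa using hxy
    have h3 : x.edge ^ 2 = y.edge ^ 2 := by
      have := (hS x hx).trans (hS y hy).symm
      rw [disc, disc, h1, h2] at this
      linarith
    have h4 : x.edge = y.edge := by
      rcases sq_eq_sq_iff_eq_or_eq_neg.1 h3 with h | h
      · exact h
      · simp only [Set.mem_ofPred_eq, IsClimbing] at hxc hyc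
        omega
    have h5 := x.back_eq
    have h6 := y.back_eq
    have h7 : x.back = y.back := by omega
    exact Subtype.ext (EdgeFlag.ext h1 h2 h7)
  refine Summable.of_norm_bounded
    ((hprod.comp_injective hinj).mul_left ((D : ℝ) ^ 2 / 16 / (1 - √((D : ℝ) / (D + 4))))) ?_
  rintro ⟨x, hx, hxc⟩
  have h1 : (x.edge : ℝ) ^ 2 = D + 4 * (x.left * x.right) := by
    have := hS x hx
    rw [disc] at this
    exact_mod_cast (by linarith : x.edge ^ 2 = D + 4 * (x.left * x.right))
  have h2 : (1 : ℝ) ≤ x.left * x.right := by exact_mod_cast hxc.mul_pos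
  have hD' : (0 : ℝ) < D := by exact_mod_cast hD
  have h3 : 0 < |(x.edge : ℝ)| := (Real.sqrt_nonneg _).trans_lt (sqrt_lt_of_disc hD.le (hS x hx) hxc.mul_pos)
  have := abs_artanhTail_sqrt_div_le hD' h2 h3 (by rwa [sq_abs])
  simp only [Function.comp_apply, Real.norm_eq_abs, tail]
  refine this.trans_eq ?_
  rw [mul_pow, one_div_mul_one_div]

/-- Each term is a tail minus the tails of its two children. Absolute convergence allows the three
sums to be separated, and every climbing edge that is not a root cancels as a child. -/
theorem hasSum_isClimbing (h : Closed S) (hD : 0 < D) (hsq : ¬ IsSquare D)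
    (hS : ∀ x ∈ S, x.disc = D) :
    HasSum ((S ∩ {x | x.IsClimbing}).indicator (frontTerm D))
      (∑' x, (S ∩ {x | x.IsRoot}).indicator (tail D) x) := by
  have hdec := h.indicator_isClimbing (fun x hx => by rwa [hS x hx])
    (fun x hx => by rwa [hS x hx]) (tail D)
  have hc := summable_tail hD hS
  have hsub : ∀ A : Set EdgeFlag, A ⊆ S ∩ {x | x.IsClimbing} →
      Summable (A.indicator (tail D)) := by
    intro A hA
    have := hc.indicator A
    rwa [Set.indicator_indicator, Set.inter_eq_left.2 hA] at this
  have hL := hsub (EdgeFlag.turnLeft '' (S ∩ {x | x.IsClimbing})) (by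
    rintro _ ⟨x, ⟨hx, hxc⟩, rfl⟩
    exact ⟨h.turnLeft hx, hxc.turnLeft⟩)
  have hR := hsub (EdgeFlag.turnRight '' (S ∩ {x | x.IsClimbing})) (by
    rintro _ ⟨x, ⟨hx, hxc⟩, rfl⟩
    exact ⟨h.turnRight hx, hxc.turnRight⟩)
  have hroot := hsub (S ∩ {x | x.IsRoot}) (fun x hx => ⟨hx.1, isClimbing_of_isRoot hx.2⟩)
  have key : ∑' x, (S ∩ {x | x.IsRoot}).indicator (tail D) x =
      ∑' x, (S ∩ {x | x.IsClimbing}).indicator (tail D) x -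
      ∑' x, (EdgeFlag.turnLeft '' (S ∩ {x | x.IsClimbing})).indicator (tail D) x -
      ∑' x, (EdgeFlag.turnRight '' (S ∩ {x | x.IsClimbing})).indicator (tail D) x := by
    have h1 := (hL.hasSum.add hR.hasSum).add hroot.hasSum
    have h2 := hc.hasSum
    rw [hdec] at h2
    have := h2.unique h1
    rw [hdec, this]
    ring
  rw [key]
  -- The sums over children are pulled back to sums over parents.
  have hL' := (turnLeftEquiv.hasSum_iff).2 hL.hasSum
  have hR' := (turnRightEquiv.hasSum_iff).2 hR.hasSum
  refine ((hc.hasSum.sub hL').sub hR').congr_fun ?_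
  intro x
  have m1 : turnLeftEquiv x ∈ EdgeFlag.turnLeft '' (S ∩ {x | x.IsClimbing}) ↔
      x ∈ S ∩ {x | x.IsClimbing} := turnLeftEquiv.injective.mem_set_image
  have m2 : turnRightEquiv x ∈ EdgeFlag.turnRight '' (S ∩ {x | x.IsClimbing}) ↔
      x ∈ S ∩ {x | x.IsClimbing} := turnRightEquiv.injective.mem_set_image
  by_cases hx : x ∈ S ∩ {x | x.IsClimbing}
  · simp only [Function.comp_apply, Set.indicator_of_mem hx, Set.indicator_of_mem (m1.2 hx),
      Set.indicator_of_mem (m2.2 hx)]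
    exact frontTerm_of_isClimbing hD (hS x hx.1) hx.2
  · simp only [Function.comp_apply, Set.indicator_of_notMem hx,
      Set.indicator_of_notMem (fun hh => hx (m1.1 hh)),
      Set.indicator_of_notMem (fun hh => hx (m2.1 hh)), sub_zero]

/-- Summed over all edges directed away from the river or along it rightwards, the terms at their
final vertices reduce to a finite sum over the river. -/
theorem hasSum_frontTerm (h : Closed S) (hD : 0 < D) (hsq : ¬ IsSquare D)
    (hS : ∀ x ∈ S, x.disc = D) :
    HasSum (fun x : ↥(S ∩ {x | x.IsClimbing ∨ x.IsRiver}) => frontTerm D x.1)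
      (∑ᶠ x ∈ S ∩ {x | x.IsRiver}, Real.artanh (√D / |(x.exit.edge : ℝ)|)) := by
  classical
  have hsq' : ∀ x ∈ S, ¬ IsSquare x.disc := fun x hx => by rwa [hS x hx]
  have hfin : (S ∩ {x | x.IsRiver}).Finite :=
    (finite_isRiver D).subset fun x hx => ⟨hS x hx.1, hx.2⟩
  have hroot : ∑' x, (S ∩ {x | x.IsRoot}).indicator (tail D) x =
      ∑ᶠ x ∈ S ∩ {x | x.IsRiver}, tail D x.exit := by
    have hb := h.bijOn_exit hsq'
    have hfin' : (S ∩ {x | x.IsRoot}).Finite := hb.image_eq ▸ hfin.image _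
    rw [(hasSum_indicator_of_finite hfin' _).tsum_eq]
    exact (finsum_mem_eq_of_bijOn EdgeFlag.exit hb fun x _ => rfl).symm
  have hriver := hasSum_indicator_of_finite hfin (frontTerm D)
  have htot := (h.hasSum_isClimbing hD hsq hS).add hriver
  rw [hroot, ← finsum_mem_add_distrib hfin] at htot
  have hval : ∑ᶠ x ∈ S ∩ {x | x.IsRiver}, (tail D x.exit + frontTerm D x) =
      ∑ᶠ x ∈ S ∩ {x | x.IsRiver}, Real.artanh (√D / |(x.exit.edge : ℝ)|) :=
    finsum_mem_congr rfl fun x hx => by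
      rw [add_comm]
      exact frontTerm_add_tail_exit hD (hS x hx.1) (front_ne_zero (hsq' x hx.1)) hx.2
  rw [hval] at htot
  have hind : (S ∩ {x | x.IsClimbing ∨ x.IsRiver}).indicator (frontTerm D) =
      fun x => (S ∩ {x | x.IsClimbing}).indicator (frontTerm D) x +
        (S ∩ {x | x.IsRiver}).indicator (frontTerm D) x := by
    have hu : S ∩ {x | x.IsClimbing ∨ x.IsRiver} =
        (S ∩ {x | x.IsClimbing}) ∪ (S ∩ {x | x.IsRiver}) := by
      rw [← Set.inter_union_distrib_left]
      rfl
    rw [hu, Set.indicator_union_of_disjoint]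
    rw [Set.disjoint_left]
    exact fun x hx hx' => not_isRiver_of_isClimbing hx.2 hx'.2
  rw [← hind] at htot
  exact (hasSum_subtype_iff_indicator (f := frontTerm D)).2 htot

end Closed

end EdgeFlag

/-! ### Connectedness of the river -/

namespace EdgeFlag

theorem exit_disc (x : EdgeFlag) : x.exit.disc = x.disc := by
  unfold exit
  split_ifs
  exacts [x.disc_turnLeft, x.disc_turnRight]

theorem next_disc (x : EdgeFlag) : x.next.disc = x.disc := by
  unfold next
  split_ifs
  exacts [x.disc_turnRight, x.disc_turnLeft]

/-- The flags reached from `C` by turning left and right repeatedly. -/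
inductive Reach (C : Set EdgeFlag) : EdgeFlag → Prop
  | base {x : EdgeFlag} : x ∈ C → Reach C x
  | turnLeft {x : EdgeFlag} : Reach C x → Reach C x.turnLeft
  | turnRight {x : EdgeFlag} : Reach C x → Reach C x.turnRight

theorem Reach.exists_eq {C : Set EdgeFlag} (hC : C ⊆ next '' C) {x : EdgeFlag} (h : Reach C x) :
    ∃ y, Reach C y ∧ (x = y.turnLeft ∨ x = y.turnRight) := by
  cases h with
  | base hx =>
    obtain ⟨y, hy, rfl⟩ := hC hx
    refine ⟨y, .base hy, ?_⟩
    unfold next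
    split_ifs
    exacts [Or.inr rfl, Or.inl rfl]
  | turnLeft h => exact ⟨_, h, Or.inl rfl⟩
  | turnRight h => exact ⟨_, h, Or.inr rfl⟩

/-- Rotating a right turn gives the left turn from the same edge, and rotating a left turn gives the
reversal of that edge. The hypothesis on `C` gives every reached flag, including those of `C`, such
a predecessor. -/
theorem closed_reach {C : Set EdgeFlag} (hC : C ⊆ next '' C) :
    Closed {x | Reach C x ∨ Reach C x.symm} where
  rot := by
    rintro x (h | h)
    · obtain ⟨y, hy, rfl | rfl⟩ := h.exists_eq hC
      · exact Or.inr (by simpa only [← rot_rot_symm, rot_rot_rot, symm_symm] using hy)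
      · exact Or.inl hy.turnLeft
    · have := h.turnRight
      rw [← rot_symm, symm_symm] at this
      exact Or.inl this
  symm := by
    rintro x (h | h)
    · exact Or.inr (by rwa [symm_symm])
    · exact Or.inl h

/-- From an edge of `C` one turn stays in `C` and the other leaves the river; once off the river,
every further turn climbs. -/
theorem Reach.mem_or_isClimbing {C : Set EdgeFlag} (hnext : Set.MapsTo next C C)
    (hriver : ∀ x ∈ C, x.IsRiver) (hfront : ∀ x ∈ C, x.front ≠ 0) {x : EdgeFlag}
    (h : Reach C x) : x ∈ C ∨ x.IsClimbing := by
  have key : ∀ x ∈ C, (x.turnLeft ∈ C ∨ x.turnLeft.IsClimbing) ∧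
      (x.turnRight ∈ C ∨ x.turnRight.IsClimbing) := by
    intro x hx
    have h1 := hnext hx
    have h2 := isClimbing_of_isRoot ((hriver x hx).isRoot_exit (hfront x hx))
    unfold next at h1
    unfold exit at h2
    split_ifs at h1 h2
    exacts [⟨Or.inr h2, Or.inl h1⟩, ⟨Or.inl h1, Or.inr h2⟩]
  induction h with
  | base hx => exact Or.inl hx
  | turnLeft _ ih => exact ih.elim (fun h => (key _ h).1) fun h => Or.inr h.turnLeft
  | turnRight _ ih => exact ih.elim (fun h => (key _ h).2) fun h => Or.inr h.turnRight

theorem mem_of_reach_of_isRiver {C : Set EdgeFlag} (hnext : Set.MapsTo next C C)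
    (hriver : ∀ x ∈ C, x.IsRiver) (hfront : ∀ x ∈ C, x.front ≠ 0) {x : EdgeFlag}
    (hx : x.IsRiver) (h : Reach C x ∨ Reach C x.symm) : x ∈ C := by
  rcases h with h | h
  · exact (h.mem_or_isClimbing hnext hriver hfront).resolve_right
      fun hc => not_isRiver_of_isClimbing hc hx
  · exfalso
    rcases h.mem_or_isClimbing hnext hriver hfront with h | h
    · exact hx.1.not_gt (hriver _ h).2
    · exact (mul_neg_of_neg_of_pos hx.2 hx.1).not_gt h.mul_pos

/-! ### The quadratic form and its bases along the river -/

/-- The quadratic form with values `x.left` and `x.right` on the standard basis and `x.front` on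
its sum. -/
def form (x : EdgeFlag) (m n : ℤ) : ℤ := x.left * m ^ 2 + x.edge * m * n + x.right * n ^ 2

/-- For `s = ±√D`, the linear factors of `4 * x.left * x.form`. -/
noncomputable def linFactor (x : EdgeFlag) (s : ℝ) (m n : ℤ) : ℝ :=
  2 * x.left * m + (x.edge + s) * n

theorem linFactor_add (x : EdgeFlag) (s : ℝ) (m n m' n' : ℤ) :
    x.linFactor s (m + m') (n + n') = x.linFactor s m n + x.linFactor s m' n' := by
  simp only [linFactor]
  push_cast
  ring

theorem linFactor_mul_linFactor {x : EdgeFlag} {s : ℝ} (hs : s ^ 2 = x.disc) (m n : ℤ) :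
    x.linFactor s m n * x.linFactor (-s) m n = 4 * x.left * x.form m n := by
  rw [disc] at hs
  push_cast at hs
  simp only [linFactor, form]
  push_cast
  linear_combination (-(n : ℝ) ^ 2) * hs

end EdgeFlag

open EdgeFlag

/-- A pair of integer vectors `(p, q)` and `(s, t)`. -/
@[ext]
structure FormBasis where
  p : ℤ
  q : ℤ
  s : ℤ
  t : ℤ

namespace FormBasis

variable (x : EdgeFlag)

/-- The values of the form on the two vectors and their difference. -/
def flag (f : FormBasis) : EdgeFlag :=
  ⟨x.form f.p f.q, x.form f.s f.t, x.form (f.p - f.s) (f.q - f.t)⟩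

/-- The basis belonging to the next river edge. -/
def step (f : FormBasis) : FormBasis :=
  if 0 < x.form (f.p + f.s) (f.q + f.t) then ⟨f.p + f.s, f.q + f.t, f.s, f.t⟩
  else ⟨f.p, f.q, f.p + f.s, f.q + f.t⟩

/-- The standard basis. -/
def std : FormBasis := ⟨1, 0, 0, 1⟩

theorem flag_std : std.flag x = x := by
  ext <;> simp only [flag, std, form, edge] <;> ring

theorem front_flag (f : FormBasis) : (f.flag x).front = x.form (f.p + f.s) (f.q + f.t) := by
  simp only [flag, form, front]
  ring

theorem edge_flag (f : FormBasis) : (f.flag x).edge =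
    2 * x.left * f.p * f.s + x.edge * (f.p * f.t + f.q * f.s) + 2 * x.right * f.q * f.t := by
  simp only [flag, form, edge]
  ring

/-- This lifts the walk along the river from labels to bases. The lift still records the change of
basis when the labels return after a period. -/
theorem flag_step (f : FormBasis) : (f.step x).flag x = (f.flag x).next := by
  rw [next, front_flag, step]
  split_ifs <;> ext <;> simp only [turnRight, turnLeft, front_flag] <;>
    simp only [flag, form] <;> ring

theorem flag_iterate (k : ℕ) : ((step x)^[k] std).flag x = next^[k] x := by
  induction k with
  | zero => exact flag_std x
  | succ k ih => rw [Function.iterate_succ_apply', Function.iterate_succ_apply', flag_step, ih]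

theorem disc_flag (f : FormBasis) (h : f.p * f.t - f.q * f.s = 1) :
    (f.flag x).disc = x.disc := by
  rw [disc, disc, edge_flag]
  simp only [flag, form]
  linear_combination (x.edge ^ 2 - 4 * x.left * x.right) * (f.p * f.t - f.q * f.s + 1) * h

/-- The bases in the first quadrant that belong to edges of the river. -/
structure IsAdapted (f : FormBasis) : Prop where
  p_nonneg : 0 ≤ f.p
  q_nonneg : 0 ≤ f.q
  s_nonneg : 0 ≤ f.s
  t_nonneg : 0 ≤ f.t
  det : f.p * f.t - f.q * f.s = 1
  isRiver : (f.flag x).IsRiver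

variable {x}

theorem isAdapted_std (hx : x.IsRiver) : std.IsAdapted x :=
  ⟨by simp [std], by simp [std], by simp [std], by simp [std], by simp [std], by rwa [flag_std]⟩

theorem IsAdapted.step (hsq : ¬ IsSquare x.disc) {f : FormBasis} (h : f.IsAdapted x) :
    (f.step x).IsAdapted x := by
  have hf : (f.flag x).front ≠ 0 := front_ne_zero (by rwa [disc_flag x f h.det])
  have hr := h.isRiver.next hf
  rw [← flag_step] at hr
  obtain ⟨h1, h2, h3, h4, h5, -⟩ := h
  have hd : (f.step x).p * (f.step x).t - (f.step x).q * (f.step x).s = 1 := by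
    unfold FormBasis.step
    split_ifs <;> linear_combination h5
  refine ⟨?_, ?_, ?_, ?_, hd, hr⟩ <;> unfold FormBasis.step <;> split_ifs <;> simp only <;> omega

theorem isAdapted_iterate (hsq : ¬ IsSquare x.disc) (hx : x.IsRiver) (k : ℕ) :
    ((step x)^[k] std).IsAdapted x := by
  induction k with
  | zero => exact isAdapted_std hx
  | succ k ih => rw [Function.iterate_succ_apply']; exact ih.step hsq

theorem abs_edge_lt_sqrt_disc (hx : x.IsRiver) : |(x.edge : ℝ)| < √(x.disc : ℝ) := by
  rw [← Real.sqrt_sq_eq_abs]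
  apply Real.sqrt_lt_sqrt (sq_nonneg _)
  have := mul_neg_of_pos_of_neg hx.1 hx.2
  have h : x.edge ^ 2 < x.disc := by rw [disc]; linarith
  exact_mod_cast h

theorem disc_pos (hx : x.IsRiver) : 0 < x.disc := by
  have := mul_neg_of_pos_of_neg hx.1 hx.2
  rw [disc]
  nlinarith [sq_nonneg x.edge]

theorem sq_sqrt_disc (hx : x.IsRiver) : √(x.disc : ℝ) ^ 2 = x.disc :=
  Real.sq_sqrt (by exact_mod_cast (disc_pos hx).le)

/-- On the river |edge| < √disc, so both coefficients of this factor are positive. In the first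
quadrant the sign of the form is thus that of the other factor, which is additive. -/
theorem linFactor_pos (hx : x.IsRiver) {m n : ℤ} (hm : 0 ≤ m) (hn : 0 ≤ n) (h : 0 < m + n) :
    0 < x.linFactor √x.disc m n := by
  have h1 := (abs_lt.1 (abs_edge_lt_sqrt_disc hx)).1
  have h2 : (0 : ℝ) < x.left := by exact_mod_cast hx.1
  have h3 : 0 < (x.edge : ℝ) + √x.disc := by linarith
  have hm' : (0 : ℝ) ≤ m := by exact_mod_cast hm
  have hn' : (0 : ℝ) ≤ n := by exact_mod_cast hn
  unfold linFactor
  rcases hm.lt_or_eq with hm2 | rfl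
  · have : (0 : ℝ) < m := by exact_mod_cast hm2
    positivity
  · have : (0 : ℝ) < n := by exact_mod_cast (by omega : 0 < n)
    push_cast
    positivity

theorem form_pos_iff (hx : x.IsRiver) {m n : ℤ} (hm : 0 ≤ m) (hn : 0 ≤ n) (h : 0 < m + n) :
    0 < x.form m n ↔ 0 < x.linFactor (-√x.disc) m n := by
  have h1 := linFactor_pos hx hm hn h
  have h2 := linFactor_mul_linFactor (sq_sqrt_disc hx) m n
  have h3 : (0 : ℝ) < x.left := by exact_mod_cast hx.1
  rw [← Int.cast_pos (R := ℝ), ← mul_pos_iff_of_pos_left (show 0 < 4 * (x.left : ℝ) by positivity),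
    ← h2, mul_pos_iff_of_pos_left h1]

theorem form_neg_iff (hx : x.IsRiver) {m n : ℤ} (hm : 0 ≤ m) (hn : 0 ≤ n) (h : 0 < m + n) :
    x.form m n < 0 ↔ x.linFactor (-√x.disc) m n < 0 := by
  have h1 := linFactor_pos hx hm hn h
  have h2 := linFactor_mul_linFactor (sq_sqrt_disc hx) m n
  have h3 : (0 : ℝ) < x.left := by exact_mod_cast hx.1
  have h4 : 0 < 4 * (x.left : ℝ) := by positivity
  rw [← Int.cast_lt_zero (R := ℝ)]
  constructor <;> intro h5 <;> by_contra! h6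
  · linarith [mul_nonneg h1.le h6, mul_neg_of_pos_of_neg h4 h5]
  · linarith [mul_nonneg h4.le h6, mul_neg_of_pos_of_neg h1 h5]

theorem IsAdapted.pq_pos {f : FormBasis} (h : f.IsAdapted x) : 0 < f.p + f.q := by
  by_contra! hc
  have h1 : f.p = 0 := by linarith [h.p_nonneg, h.q_nonneg]
  have h2 : f.q = 0 := by linarith [h.p_nonneg, h.q_nonneg]
  simpa [h1, h2] using h.det

theorem IsAdapted.st_pos {f : FormBasis} (h : f.IsAdapted x) : 0 < f.s + f.t := by
  by_contra! hc
  have h1 : f.s = 0 := by linarith [h.s_nonneg, h.t_nonneg]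
  have h2 : f.t = 0 := by linarith [h.s_nonneg, h.t_nonneg]
  simpa [h1, h2] using h.det

/-- If p > s and t > q, then (s+1)(q+1) ≤ pt = 1 + qs forces s = q = 0; the opposite crossing makes
the determinant nonpositive. -/
theorem eq_std_or_le {f : FormBasis} (h : f.IsAdapted x) :
    f = std ∨ (f.s ≤ f.p ∧ f.t ≤ f.q) ∨ (f.p ≤ f.s ∧ f.q ≤ f.t) := by
  obtain ⟨h1, h2, h3, h4, h5, -⟩ := h
  by_cases h6 : f.s ≤ f.p
  · by_cases h7 : f.t ≤ f.q
    · exact Or.inr (Or.inl ⟨h6, h7⟩)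
    · by_cases h8 : f.p ≤ f.s
      · exact Or.inr (Or.inr ⟨h8, by omega⟩)
      · left
        push Not at h7 h8
        have h9 : (f.s + 1) * (f.q + 1) ≤ f.p * f.t :=
          mul_le_mul h8 h7 (by omega) h1
        have hs : f.s = 0 := by nlinarith
        have hq : f.q = 0 := by nlinarith
        rw [hs, hq] at h5
        have h10 : f.p * f.t = 1 := by linarith
        rcases Int.mul_eq_one_iff_eq_one_or_neg_one.1 h10 with ⟨hp, ht⟩ | ⟨hp, ht⟩
        · ext <;> simp [std, hs, hq, hp, ht]
        · omega
  · by_cases h7 : f.q ≤ f.t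
    · exact Or.inr (Or.inr ⟨by omega, h7⟩)
    · exfalso
      push Not at h6 h7
      have h9 : f.p * f.t ≤ f.s * f.q := mul_le_mul h6.le h7.le h4 h3
      nlinarith

/-- Euclidean descent: subtract the smaller vector from the larger. The difference takes the right
sign because the second linear factor is additive and has opposite signs at the two vectors. -/
theorem IsAdapted.exists_step (hsq : ¬ IsSquare x.disc) (hx : x.IsRiver) {f : FormBasis}
    (h : f.IsAdapted x) (hne : f ≠ std) :
    ∃ f' : FormBasis, f'.IsAdapted x ∧ f'.step x = f ∧
      f'.p + f'.q + f'.s + f'.t < f.p + f.q + f.s + f.t := by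
  have hpq := h.pq_pos
  have hst := h.st_pos
  have hb : x.form (f.p - f.s) (f.q - f.t) ≠ 0 :=
    back_ne_zero (x := f.flag x) (by rwa [disc_flag x f h.det])
  have hv : 0 < x.form f.p f.q := h.isRiver.1
  have hw : x.form f.s f.t < 0 := h.isRiver.2
  rcases (eq_std_or_le h).resolve_left hne with ⟨h1, h2⟩ | ⟨h1, h2⟩
  · have hne' : 0 < (f.p - f.s) + (f.q - f.t) := by
      by_contra! hc
      apply hb
      rw [show f.p - f.s = 0 by omega, show f.q - f.t = 0 by omega]
      simp [form]
    refine ⟨⟨f.p - f.s, f.q - f.t, f.s, f.t⟩, ⟨by simp only; omega, by simp only; omega,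
      h.s_nonneg, h.t_nonneg, by linear_combination h.det, ?_, hw⟩, ?_, by simp only; omega⟩
    · change 0 < x.form (f.p - f.s) (f.q - f.t)
      by_contra! hc
      have hneg := (form_neg_iff hx (by omega) (by omega) hne').1 (lt_of_le_of_ne hc hb)
      have hneg' := (form_neg_iff hx h.s_nonneg h.t_nonneg hst).1 hw
      have hpos := (form_pos_iff hx h.p_nonneg h.q_nonneg hpq).1 hv
      have := linFactor_add x (-√x.disc) (f.p - f.s) (f.q - f.t) f.s f.t
      rw [sub_add_cancel, sub_add_cancel] at this
      linarith
    · simp only [FormBasis.step, sub_add_cancel, if_pos hv]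
  · have hb' : x.form (f.s - f.p) (f.t - f.q) ≠ 0 := by
      rwa [show x.form (f.s - f.p) (f.t - f.q) = x.form (f.p - f.s) (f.q - f.t) by
        simp only [form]; ring]
    have hne' : 0 < (f.s - f.p) + (f.t - f.q) := by
      by_contra! hc
      apply hb'
      rw [show f.s - f.p = 0 by omega, show f.t - f.q = 0 by omega]
      simp [form]
    refine ⟨⟨f.p, f.q, f.s - f.p, f.t - f.q⟩, ⟨h.p_nonneg, h.q_nonneg, by simp only; omega,
      by simp only; omega, by linear_combination h.det, hv, ?_⟩, ?_, by simp only; omega⟩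
    · change x.form (f.s - f.p) (f.t - f.q) < 0
      by_contra! hc
      have hpos' := (form_pos_iff hx (by omega) (by omega) hne').1 (lt_of_le_of_ne hc hb'.symm)
      have hneg := (form_neg_iff hx h.s_nonneg h.t_nonneg hst).1 hw
      have hpos := (form_pos_iff hx h.p_nonneg h.q_nonneg hpq).1 hv
      have := linFactor_add x (-√x.disc) (f.s - f.p) (f.t - f.q) f.p f.q
      rw [sub_add_cancel, sub_add_cancel] at this
      linarith
    · simp only [FormBasis.step, add_sub_cancel, if_neg hw.not_gt]

/-- Every adapted basis is met when following the river from the standard one. -/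
theorem IsAdapted.exists_iterate (hsq : ¬ IsSquare x.disc) (hx : x.IsRiver) {f : FormBasis}
    (h : f.IsAdapted x) : ∃ k : ℕ, (FormBasis.step x)^[k] std = f := by
  induction hn : (f.p + f.q + f.s + f.t).toNat using Nat.strong_induction_on generalizing f with
  | _ n ih =>
    by_cases hne : f = std
    · exact ⟨0, hne.symm⟩
    · obtain ⟨f', hf', rfl, hlt⟩ := h.exists_step hsq hx hne
      have := hf'.pq_pos
      have := hf'.st_pos
      obtain ⟨k, hk⟩ := ih _ (by omega) hf' rfl
      exact ⟨k + 1, by rw [Function.iterate_succ_apply', hk]⟩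

end FormBasis

/-! ### Logarithmic height and Pell's equation -/

namespace FormBasis

variable {x : EdgeFlag}

variable (x) in
/-- The logarithmic height of a basis: half the sum of the logarithms of the quotients of the two
linear factors of the form, at the two vectors. -/
noncomputable def logHeight (f : FormBasis) : ℝ :=
  (Real.log (x.linFactor √x.disc f.p f.q) - Real.log (x.linFactor (-√x.disc) f.p f.q) +
    (Real.log (x.linFactor √x.disc f.s f.t) - Real.log (x.linFactor (-√x.disc) f.s f.t))) / 2

/-- Mixed products bring in the edge label. Added to the product of both factors at one vector, they
give the label of the exit edge ±√D. -/
theorem linFactor_mul_linFactor_swap {f : FormBasis} (hdet : f.p * f.t - f.q * f.s = 1) {s : ℝ}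
    (hs : s ^ 2 = x.disc) :
    x.linFactor s f.p f.q * x.linFactor (-s) f.s f.t = 2 * x.left * ((f.flag x).edge - s) := by
  rw [disc] at hs
  push_cast at hs
  have hd : (f.p * f.t - f.q * f.s : ℝ) = 1 := by exact_mod_cast hdet
  rw [edge_flag]
  simp only [linFactor]
  push_cast
  linear_combination (-(f.q * f.t : ℝ)) * hs - (2 * x.left * s) * hd

theorem IsAdapted.linFactor_pq_pos (hx : x.IsRiver) {f : FormBasis} (h : f.IsAdapted x) :
    0 < x.linFactor √x.disc f.p f.q ∧ 0 < x.linFactor (-√x.disc) f.p f.q :=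
  ⟨linFactor_pos hx h.p_nonneg h.q_nonneg h.pq_pos,
    (form_pos_iff hx h.p_nonneg h.q_nonneg h.pq_pos).1 h.isRiver.1⟩

theorem IsAdapted.linFactor_st_pos (hx : x.IsRiver) {f : FormBasis} (h : f.IsAdapted x) :
    0 < x.linFactor √x.disc f.s f.t ∧ x.linFactor (-√x.disc) f.s f.t < 0 :=
  ⟨linFactor_pos hx h.s_nonneg h.t_nonneg h.st_pos,
    (form_neg_iff hx h.s_nonneg h.t_nonneg h.st_pos).1 h.isRiver.2⟩

/-- Only one vector changes, and the quotient of its linear factors gets multiplied by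
(|e|+√D)/(|e|-√D) up to sign, with e the exit label. The second factor is negative at the second
vector, which is harmless since `Real.log` ignores signs. -/
theorem IsAdapted.logHeight_step (hsq : ¬ IsSquare x.disc) (hx : x.IsRiver) {f : FormBasis}
    (h : f.IsAdapted x) :
    (f.step x).logHeight x =
      f.logHeight x + Real.artanh (√x.disc / |((f.flag x).exit.edge : ℝ)|) := by
  have hstep := h.step hsq
  obtain ⟨a1, a2⟩ := h.linFactor_pq_pos hx
  obtain ⟨a3, a4⟩ := h.linFactor_st_pos hx
  obtain ⟨b1, b2⟩ := hstep.linFactor_pq_pos hx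
  obtain ⟨b3, b4⟩ := hstep.linFactor_st_pos hx
  have hdisc := disc_flag x f h.det
  have hfront : (f.flag x).front ≠ 0 := front_ne_zero (by rwa [hdisc])
  have hroot := h.isRiver.isRoot_exit hfront
  have hlt : √(x.disc : ℝ) < |((f.flag x).exit.edge : ℝ)| :=
    sqrt_lt_of_disc (disc_pos hx).le ((exit_disc _).trans hdisc) (isClimbing_of_isRoot hroot).mul_pos
  have hs0 := Real.sqrt_nonneg (x.disc : ℝ)
  have hs2 := sq_sqrt_disc hx
  have hswap := linFactor_mul_linFactor_swap h.det hs2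
  have hswap' := linFactor_mul_linFactor_swap (s := -√(x.disc : ℝ)) h.det (by rwa [neg_sq])
  rw [neg_neg] at hswap'
  have hleft : (0 : ℝ) < x.left := by exact_mod_cast hx.1
  rw [Real.artanh_div hs0 hlt]
  unfold FormBasis.step at *
  unfold exit at *
  rw [front_flag] at *
  have hv := linFactor_mul_linFactor hs2 f.p f.q
  have hw := linFactor_mul_linFactor hs2 f.s f.t
  split_ifs at * with hc
  · simp only at b1 b2 b3 b4
    have he : 0 < ((f.flag x).turnLeft.edge : ℝ) := by
      have := h.isRiver.1
      rw [← front_flag] at hc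
      rcases isClimbing_of_isRoot hroot with hh | hh
      · exact_mod_cast hh.2.2
      · exact absurd hh.1 this.not_gt
    rw [abs_of_pos he] at hlt ⊢
    have hleftf : ((f.flag x).left : ℝ) = x.form f.p f.q := rfl
    have e1 : x.linFactor √x.disc (f.p + f.s) (f.q + f.t) * x.linFactor (-√x.disc) f.p f.q =
        2 * x.left * ((f.flag x).turnLeft.edge + √x.disc) := by
      rw [linFactor_add, edge_turnLeft]
      push_cast
      rw [hleftf]
      linear_combination hv + hswap'
    have e2 : x.linFactor (-√x.disc) (f.p + f.s) (f.q + f.t) * x.linFactor √x.disc f.p f.q =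
        2 * x.left * ((f.flag x).turnLeft.edge - √x.disc) := by
      rw [linFactor_add, edge_turnLeft]
      push_cast
      rw [hleftf]
      linear_combination hv + hswap
    have l1 := congrArg Real.log e1
    have l2 := congrArg Real.log e2
    rw [Real.log_mul b1.ne' a2.ne', Real.log_mul (by positivity) (by linarith)] at l1
    rw [Real.log_mul b2.ne' a1.ne', Real.log_mul (by positivity) (by linarith)] at l2
    rw [Real.log_div (by linarith) (by linarith), logHeight, logHeight]
    linarith
  · simp only at b1 b2 b3 b4
    have he : ((f.flag x).turnRight.edge : ℝ) < 0 := by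
      have := h.isRiver.2
      rcases isClimbing_of_isRoot hroot with hh | hh
      · exact absurd hh.2.1 this.not_gt
      · exact_mod_cast hh.2.2
    rw [abs_of_neg he] at hlt ⊢
    have hrightf : ((f.flag x).right : ℝ) = x.form f.s f.t := rfl
    have e1 : x.linFactor √x.disc (f.p + f.s) (f.q + f.t) * x.linFactor (-√x.disc) f.s f.t =
        -(2 * x.left) * (-(f.flag x).turnRight.edge + √x.disc) := by
      rw [linFactor_add, edge_turnRight]
      push_cast
      rw [hrightf]
      linear_combination hw + hswap
    have e2 : x.linFactor (-√x.disc) (f.p + f.s) (f.q + f.t) * x.linFactor √x.disc f.s f.t =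
        -(2 * x.left) * (-(f.flag x).turnRight.edge - √x.disc) := by
      rw [linFactor_add, edge_turnRight]
      push_cast
      rw [hrightf]
      linear_combination hw + hswap'
    have l1 := congrArg Real.log e1
    have l2 := congrArg Real.log e2
    have hleft' : -(2 * (x.left : ℝ)) ≠ 0 := by simp [hleft.ne']
    rw [Real.log_mul b3.ne' a4.ne, Real.log_mul hleft' (by linarith)] at l1
    rw [Real.log_mul b4.ne a3.ne', Real.log_mul hleft' (by linarith)] at l2
    rw [Real.log_div (by linarith) (by linarith), logHeight, logHeight]
    linarith

theorem sum_artanh_eq_logHeight (hsq : ¬ IsSquare x.disc) (hx : x.IsRiver) (k : ℕ) :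
    ∑ i ∈ Finset.range k, Real.artanh (√x.disc / |((next^[i] x).exit.edge : ℝ)|) =
      ((step x)^[k] std).logHeight x - std.logHeight x := by
  induction k with
  | zero => simp
  | succ k ih =>
    rw [Finset.sum_range_succ, ih, Function.iterate_succ_apply',
      (isAdapted_iterate hsq hx k).logHeight_step hsq hx, flag_iterate]
    ring

/-- A basis in which the form looks as in the standard one is given by a solution of Pell's
equation. -/
theorem exists_pell {g a b c : ℤ} (hg : g ≠ 0) (ha : a ≠ 0) (hl : x.left = g * a)
    (he : x.edge = g * b) (hr : x.right = g * c) (hcop : ∃ α β γ : ℤ, α * a + β * b + γ * c = 1)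
    {f : FormBasis} (hdet : f.p * f.t - f.q * f.s = 1) (hf : f.flag x = x) :
    ∃ U : ℤ, f.q = a * U ∧ f.s = -c * U ∧ f.t - f.p = b * U ∧
      (f.p + f.t) ^ 2 - (b ^ 2 - 4 * (a * c)) * U ^ 2 = 4 := by
  obtain ⟨α, β, γ, hcop⟩ := hcop
  have h1 : x.form f.p f.q = x.left := congrArg left hf
  have h2 : x.form f.s f.t = x.right := congrArg right hf
  have h3 := congrArg edge hf
  rw [edge_flag] at h3
  simp only [form] at h1 h2
  rw [hl, he, hr] at h1 h2 h3
  have k1 : a * (f.t - f.p) = b * f.q := by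
    apply mul_left_cancel₀ hg
    apply mul_left_cancel₀ (two_ne_zero (α := ℤ))
    linear_combination -2 * f.t * h1 + f.q * h3 + g * (2 * a * f.p + b * f.q) * hdet
  have k2 : a * f.s = -c * f.q := by
    apply mul_left_cancel₀ hg
    apply mul_left_cancel₀ (two_ne_zero (α := ℤ))
    linear_combination f.t * h3 - 2 * f.q * h2 - g * (2 * a * f.s + b * f.t) * hdet
  -- Invariance makes (q, t-p, -s) proportional to (a, b, c). The Bézout coefficients extract the
  -- integral factor U.
  have hq : f.q = a * (α * f.q + β * (f.t - f.p) - γ * f.s) := by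
    linear_combination (-f.q) * hcop - β * k1 + γ * k2
  refine ⟨α * f.q + β * (f.t - f.p) - γ * f.s, hq, ?_, ?_, ?_⟩
  · apply mul_left_cancel₀ ha
    linear_combination k2 - c * hq
  · apply mul_left_cancel₀ ha
    linear_combination k1 + b * hq
  · generalize α * f.q + β * (f.t - f.p) - γ * f.s = U at hq
    have hs : f.s = -c * U := by
      apply mul_left_cancel₀ ha
      linear_combination k2 - c * hq
    have ht : f.t - f.p = b * U := by
      apply mul_left_cancel₀ ha
      linear_combination k1 + b * hq
    rw [hq, hs] at hdet
    linear_combination 4 * hdet + (f.t - f.p + b * U) * ht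

/-- An automorph multiplies one linear factor by η = (T+U√d)/2 and the other by η⁻¹, at both
vectors, so half the sum of the four logarithms grows by 2 log η. -/
theorem logHeight_of_pell (hx : x.IsRiver) {g a b c : ℤ} (hg : 0 < g) (hl : x.left = g * a)
    (he : x.edge = g * b) (hr : x.right = g * c) {f : FormBasis} {T U : ℤ} (hT : 0 < T)
    (hU : 0 ≤ U)
    (hp : 2 * f.p = T - b * U) (hq : f.q = a * U) (hs : f.s = -c * U) (ht : 2 * f.t = T + b * U)
    (hTU : T ^ 2 - (b ^ 2 - 4 * (a * c)) * U ^ 2 = 4) :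
    f.logHeight x = std.logHeight x +
      2 * Real.log ((T + U * √((b ^ 2 - 4 * (a * c) : ℤ) : ℝ)) / 2) := by
  have hdisc : x.disc = g ^ 2 * (b ^ 2 - 4 * (a * c)) := by
    rw [disc, hl, he, hr]
    ring
  set d := b ^ 2 - 4 * (a * c) with hd
  have hd0 : 0 < d := by
    have := disc_pos hx
    rw [hdisc] at this
    exact (mul_pos_iff_of_pos_left (by positivity)).1 this
  have hsqrt : √(x.disc : ℝ) = g * √(d : ℝ) := by
    rw [hdisc]
    push_cast
    rw [Real.sqrt_mul (sq_nonneg _), Real.sqrt_sq (by exact_mod_cast hg.le)]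
  have hr2 : √(d : ℝ) ^ 2 = (b : ℝ) ^ 2 - 4 * (a * c) := by
    rw [Real.sq_sqrt (by exact_mod_cast hd0.le), hd]
    push_cast
    ring
  set r := √(d : ℝ)
  have hTU' : (T : ℝ) ^ 2 - r ^ 2 * U ^ 2 = 4 := by
    rw [hr2]
    exact_mod_cast hTU
  have hp' : 2 * (f.p : ℝ) = T - b * U := by exact_mod_cast hp
  have hq' : (f.q : ℝ) = a * U := by exact_mod_cast hq
  have hs' : (f.s : ℝ) = -c * U := by exact_mod_cast hs
  have ht' : 2 * (f.t : ℝ) = T + b * U := by exact_mod_cast ht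
  have hl' : (x.left : ℝ) = g * a := by exact_mod_cast hl
  have he' : (x.edge : ℝ) = g * b := by exact_mod_cast he
  have hprod : ((T + U * r) / 2) * ((T - U * r) / 2) = 1 := by linear_combination hTU' / 4
  have hη : 0 < (T + U * r) / 2 := by
    have h1 : (0 : ℝ) < T := by exact_mod_cast hT
    have h2 : (0 : ℝ) ≤ U := by exact_mod_cast hU
    positivity
  have hη' : 0 < (T - U * r) / 2 := by
    by_contra! hc
    nlinarith
  have hlog : Real.log ((T - U * r) / 2) = -Real.log ((T + U * r) / 2) := by
    rw [← Real.log_inv, eq_inv_of_mul_eq_one_right hprod]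
  have hstd := isAdapted_std hx
  obtain ⟨a1, a2⟩ := hstd.linFactor_pq_pos hx
  obtain ⟨a3, a4⟩ := hstd.linFactor_st_pos hx
  have e1 : x.linFactor √x.disc f.p f.q =
      (T + U * r) / 2 * x.linFactor √x.disc std.p std.q := by
    simp only [linFactor, std, hsqrt, hl', he', hq']
    push_cast
    linear_combination (g * a : ℝ) * hp'
  have e2 : x.linFactor (-√x.disc) f.p f.q =
      (T - U * r) / 2 * x.linFactor (-√x.disc) std.p std.q := by
    simp only [linFactor, std, hsqrt, hl', he', hq']
    push_cast
    linear_combination (g * a : ℝ) * hp'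
  have e3 : x.linFactor √x.disc f.s f.t =
      (T + U * r) / 2 * x.linFactor √x.disc std.s std.t := by
    simp only [linFactor, std, hsqrt, hl', he', hs']
    push_cast
    linear_combination (g * (b + r) / 2 : ℝ) * ht' - (g * U / 2 : ℝ) * hr2
  have e4 : x.linFactor (-√x.disc) f.s f.t =
      (T - U * r) / 2 * x.linFactor (-√x.disc) std.s std.t := by
    simp only [linFactor, std, hsqrt, hl', he', hs']
    push_cast
    linear_combination (g * (b - r) / 2 : ℝ) * ht' - (g * U / 2 : ℝ) * hr2
  rw [logHeight, e1, e2, e3, e4, Real.log_mul hη.ne' a1.ne', Real.log_mul hη'.ne' a2.ne',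
    Real.log_mul hη.ne' a3.ne', Real.log_mul hη'.ne' a4.ne, hlog, logHeight]
  ring

/-- Every positive solution of Pell's equation comes from going along the river by periods. -/
theorem exists_iterate_of_pell (hsq : ¬ IsSquare x.disc) (hx : x.IsRiver) {g a b c : ℤ} (hg : 0 < g)
    (hl : x.left = g * a) (he : x.edge = g * b) (hr : x.right = g * c) {T U : ℤ}
    (hTU : (T, U) ∈ pellSolutions (b ^ 2 - 4 * (a * c))) :
    ∃ k : ℕ, 0 < k ∧ next^[k] x = x ∧ ((step x)^[k] std).logHeight x = std.logHeight x +
      2 * Real.log ((T + U * √((b ^ 2 - 4 * (a * c) : ℤ) : ℝ)) / 2) := by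
  obtain ⟨hT, hU, hTU⟩ := hTU
  simp only at hT hU hTU
  obtain ⟨hx1, hx2⟩ := id hx
  rw [hl] at hx1
  rw [hr] at hx2
  have ha : 0 < a := (mul_pos_iff_of_pos_left hg).1 hx1
  have hc : c < 0 := by
    by_contra! hc
    exact hx2.not_ge (mul_nonneg hg.le hc)
  -- T - bU and T + bU have the same parity and their product 4 - 4acU² is even.
  have hpar : Even (T - b * U) := by
    have h1 : Even ((T - b * U) * (T + b * U)) :=
      ⟨2 - 2 * (a * c) * U ^ 2, by linear_combination hTU⟩
    rcases Int.even_mul.1 h1 with h | h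
    · exact h
    · have : T - b * U = T + b * U - 2 * (b * U) := by ring
      rw [this]
      exact h.sub (even_two_mul _)
  obtain ⟨p, hp⟩ := hpar
  -- Since ac < 0, T² exceeds b²U²; this puts the new basis in the first quadrant.
  have hlt : |b * U| < T := by
    apply abs_lt_of_sq_lt_sq _ hT.le
    have := mul_neg_of_pos_of_neg ha hc
    nlinarith [mul_pos hU hU]
  obtain ⟨hlt1, hlt2⟩ := abs_lt.1 hlt
  have hdet : p * (p + b * U) - a * U * (-c * U) = 1 := by
    have hT' : T = 2 * p + b * U := by linarith
    rw [hT'] at hTU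
    linarith
  have hflag : FormBasis.flag x ⟨p, a * U, -c * U, p + b * U⟩ = x := by
    have h1 : x.form p (a * U) = x.left := by
      simp only [form, hl, he, hr]
      linear_combination (g * a) * hdet
    have h2 : x.form (-c * U) (p + b * U) = x.right := by
      simp only [form, hl, he, hr]
      linear_combination (g * c) * hdet
    have h3 : (FormBasis.flag x ⟨p, a * U, -c * U, p + b * U⟩).edge = x.edge := by
      rw [edge_flag]
      simp only [hl, he, hr]
      linear_combination (g * b) * hdet
    have h4 := back_eq x
    have h5 := back_eq (FormBasis.flag x ⟨p, a * U, -c * U, p + b * U⟩)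
    rw [h3] at h5
    change _ = x.form p (a * U) + x.form (-c * U) (p + b * U) - _ at h5
    rw [h1, h2, ← h4] at h5
    exact EdgeFlag.ext h1 h2 h5
  have hadapt : IsAdapted x ⟨p, a * U, -c * U, p + b * U⟩ :=
    ⟨by simp only; linarith, by positivity, mul_nonneg (by linarith) hU.le,
      by simp only; linarith, hdet, by rwa [hflag]⟩
  obtain ⟨k, hk⟩ := hadapt.exists_iterate hsq hx
  refine ⟨k, Nat.pos_of_ne_zero ?_, ?_, ?_⟩
  · rintro rfl
    have := congrArg FormBasis.q hk
    simp only [std, Function.iterate_zero, id] at this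
    exact (mul_pos ha hU).ne this
  · rw [← flag_iterate, hk, hflag]
  · rw [hk]
    exact logHeight_of_pell hx hg hl he hr hT hU.le (by simp only; linarith) rfl rfl
      (by simp only; linarith) hTU

end FormBasis

/-! ### The sum over one period of the river -/

namespace EdgeFlag

/-- If the three labels differ in sign, a rightward river edge ends at the vertex. If not, the edge
label is nonzero, and either the reversed edge climbs or `lt_or_lt_of_disc_pos` supplies another
climbing edge. -/
theorem exists_isClimbing_or_isRiver {x : EdgeFlag} (h1 : x.left ≠ 0) (h2 : x.right ≠ 0)
    (h3 : x.back ≠ 0) (hd : 0 < x.disc) :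
    (x.symm.IsClimbing ∨ x.symm.IsRiver) ∨ (x.rot.symm.IsClimbing ∨ x.rot.symm.IsRiver) ∨
      (x.rot.rot.symm.IsClimbing ∨ x.rot.rot.symm.IsRiver) := by
  have h4 := lt_or_lt_of_disc_pos hd
  have h5 : x.edge = 0 → x.left * x.right < 0 := fun h => by
    rw [disc, h] at hd
    linarith
  have h6 : 0 < x.left * x.right → x.edge ≠ 0 := fun h h' => (h5 h').not_gt h
  clear h5 hd
  rcases h1.lt_or_gt with h1 | h1 <;> rcases h2.lt_or_gt with h2 | h2 <;>
    rcases h3.lt_or_gt with h3 | h3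
  · have h7 := h6 (mul_pos_of_neg_of_neg h1 h2)
    clear h6
    simp only [IsClimbing, edge, rot, symm, front] at *
    omega
  · right; right; right; exact ⟨h3, h2⟩
  · left; right; exact ⟨h2, h1⟩
  · left; right; exact ⟨h2, h1⟩
  · right; left; right; exact ⟨h1, h3⟩
  · right; right; right; exact ⟨h3, h2⟩
  · right; left; right; exact ⟨h1, h3⟩
  · have h7 := h6 (mul_pos h1 h2)
    clear h6
    simp only [IsClimbing, edge, rot, symm, front] at *
    omega

/-- Going down along edges directed away from the river, one arrives at the river. -/
theorem Closed.exists_isRiver {S : Set EdgeFlag} (h : Closed S) {D : ℤ} (hD : 0 < D)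
    (hsq : ¬ IsSquare D) (hS : ∀ x ∈ S, x.disc = D) {x : EdgeFlag} (hx : x ∈ S)
    (hc : x.IsClimbing) : ∃ y ∈ S, y.IsRiver := by
  induction hn : x.edge.natAbs using Nat.strong_induction_on generalizing x with
  | _ n ih =>
    have hb := back_ne_zero (x := x) (by rwa [hS x hx])
    have hlt := lt_or_lt_of_disc_pos (x := x) (by rwa [hS x hx])
    have e1 : x.rot.symm.edge = x.right - x.left - x.back := by
      simp only [edge, EdgeFlag.rot, EdgeFlag.symm, front]; ring
    have e2 : x.rot.rot.symm.edge = x.left - x.right - x.back := by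
      simp only [edge, EdgeFlag.rot, EdgeFlag.symm, front]; ring
    have hx1 := h.symm _ (h.rot _ hx)
    have hx2 := h.symm _ (h.rot _ (h.rot _ hx))
    have e0 := x.back_eq
    rcases hc with ⟨h1, h2, h3⟩ | ⟨h1, h2, h3⟩
    · rcases hb.lt_or_gt with h4 | h4
      · exact ⟨_, hx1, h1, h4⟩
      · rcases hlt.1 h1 h2 h3 with h5 | h5
        · exact ih _ (by omega) hx1 (Or.inl ⟨h1, h4, by omega⟩) rfl
        · exact ih _ (by omega) hx2 (Or.inl ⟨h4, h2, by omega⟩) rfl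
    · rcases hb.lt_or_gt with h4 | h4
      · rcases hlt.2 h1 h2 h3 with h5 | h5
        · exact ih _ (by omega) hx1 (Or.inr ⟨h1, h4, by omega⟩) rfl
        · exact ih _ (by omega) hx2 (Or.inr ⟨h4, h2, by omega⟩) rfl
      · exact ⟨_, hx2, h4, h2⟩

theorem iterate_next_disc (x : EdgeFlag) (k : ℕ) : (next^[k] x).disc = x.disc := by
  induction k with
  | zero => rfl
  | succ k ih => rw [Function.iterate_succ_apply', next_disc, ih]

theorem iterate_next_isRiver {x : EdgeFlag} (hsq : ¬ IsSquare x.disc) (hx : x.IsRiver) (k : ℕ) :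
    (next^[k] x).IsRiver := by
  rw [← FormBasis.flag_iterate]
  exact (FormBasis.isAdapted_iterate hsq hx k).isRiver

/-- The sum of `artanh (√D / |e|)` over the edges `e` leaving the river, over one period. -/
theorem finsum_artanh_eq_log_pellUnit {S : Set EdgeFlag} (hS : Closed S) {x : EdgeFlag}
    (hxS : x ∈ S) (hmin : ∀ W : Set EdgeFlag, Closed W → x ∈ W → S ⊆ W)
    (hsq : ¬ IsSquare x.disc) (hx : x.IsRiver) {g a b c : ℤ} (hg : 0 < g)
    (hl : x.left = g * a) (he : x.edge = g * b) (hr : x.right = g * c)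
    (hcop : ∃ α β γ : ℤ, α * a + β * b + γ * c = 1) :
    ∑ᶠ y ∈ S ∩ {y | y.IsRiver}, Real.artanh (√x.disc / |(y.exit.edge : ℝ)|) =
      2 * Real.log (pellUnit (b ^ 2 - 4 * (a * c))) := by
  have hdisc : x.disc = g ^ 2 * (b ^ 2 - 4 * (a * c)) := by
    rw [disc, hl, he, hr]
    ring
  have hd0 : 0 < b ^ 2 - 4 * (a * c) := by
    have := FormBasis.disc_pos hx
    rw [hdisc] at this
    exact (mul_pos_iff_of_pos_left (by positivity)).1 this
  have hdsq : ¬ IsSquare (b ^ 2 - 4 * (a * c)) := by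
    rintro ⟨r, hr⟩
    exact hsq ⟨g * r, by rw [hdisc, hr]; ring⟩
  have hex := exists_smallest_pellSolution _ hd0 hdsq
  rw [pellUnit, dif_pos hex]
  obtain ⟨hmem, hleast⟩ := hex.choose_spec
  set P := hex.choose
  obtain ⟨k, hk, hkx, hkh⟩ := FormBasis.exists_iterate_of_pell hsq hx hg hl he hr (T := P.1)
    (U := P.2) hmem
  set A : EdgeFlag → ℝ := fun y => Real.artanh (√x.disc / |(y.exit.edge : ℝ)|) with hA
  have hsumk : ∑ i ∈ Finset.range k, A (next^[i] x) =
      2 * Real.log ((P.1 + P.2 * √((b ^ 2 - 4 * (a * c) : ℤ) : ℝ)) / 2) := by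
    rw [hA, FormBasis.sum_artanh_eq_logHeight hsq hx, hkh]
    ring
  set n := Function.minimalPeriod next x with hn
  have hper : Function.IsPeriodicPt next k x := hkx
  have hnpos : 0 < n := hper.minimalPeriod_pos hk
  have hnk : n ≤ k := hper.minimalPeriod_le hk
  have hnx : next^[n] x = x := Function.iterate_minimalPeriod
  have hinjOn : Set.InjOn (fun i => next^[i] x) (Finset.range n : Set ℕ) := by
    intro i hi j hj hij
    exact Function.iterate_injOn_Iio_minimalPeriod (by simpa using hi) (by simpa using hj) hij
  -- The cycle `C` and what is reached from it form a closed set, which contains S by minimality;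
  -- river edges in that set lie on `C`.
  have hset : S ∩ {y | y.IsRiver} = (fun i => next^[i] x) '' (Finset.range n : Set ℕ) := by
    ext y
    constructor
    · rintro ⟨hyS, hy⟩
      set C := (fun i => next^[i] x) '' (Finset.range n : Set ℕ) with hC
      have hmemC : ∀ i, next^[i] x ∈ C := fun i =>
        ⟨i % n, by simpa using Nat.mod_lt _ hnpos, Function.iterate_mod_minimalPeriod_eq⟩
      have hCsub : C ⊆ next '' C := by
        rintro _ ⟨i, -, rfl⟩
        refine ⟨next^[i + (n - 1)] x, hmemC _, ?_⟩
        rw [← Function.iterate_succ_apply' next, show (i + (n - 1)).succ = i + n by omega,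
          Function.iterate_add_apply, hnx]
      have hxC : x ∈ C := hmemC 0
      have hyW := hmin _ (closed_reach hCsub) (Or.inl (.base hxC)) hyS
      refine mem_of_reach_of_isRiver ?_ ?_ ?_ hy hyW
      · rintro _ ⟨i, -, rfl⟩
        change next (next^[i] x) ∈ C
        rw [← Function.iterate_succ_apply' next]
        exact hmemC _
      · rintro _ ⟨i, -, rfl⟩
        exact iterate_next_isRiver hsq hx i
      · rintro _ ⟨i, -, rfl⟩
        exact front_ne_zero (by rwa [iterate_next_disc])
    · rintro ⟨i, -, rfl⟩
      refine ⟨?_, iterate_next_isRiver hsq hx i⟩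
      change next^[i] x ∈ S
      clear * - hS hxS
      induction i with
      | zero => exact hxS
      | succ i ih => rw [Function.iterate_succ_apply']; exact hS.next ih
  have hfinsum : ∑ᶠ y ∈ S ∩ {y | y.IsRiver}, A y = ∑ i ∈ Finset.range n, A (next^[i] x) := by
    rw [hset, finsum_mem_image hinjOn, finsum_mem_coe_finset]
  rw [hfinsum]
  have hApos : ∀ i, 0 < A (next^[i] x) := by
    intro i
    have hy := iterate_next_isRiver hsq hx i
    have hyd := iterate_next_disc x i
    set y := next^[i] x
    have hroot := hy.isRoot_exit (front_ne_zero (by rwa [hyd]))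
    have hlt := sqrt_lt_of_disc (FormBasis.disc_pos hx).le ((exit_disc y).trans hyd)
      (isClimbing_of_isRoot hroot).mul_pos
    have hs : 0 < √(x.disc : ℝ) := Real.sqrt_pos.2 (by exact_mod_cast FormBasis.disc_pos hx)
    exact Real.artanh_pos ⟨div_pos hs (hs.trans hlt), (div_lt_one (hs.trans hlt)).2 hlt⟩
  -- The least period is at most the number k of steps belonging to the smallest Pell solution, and
  -- the terms are positive. Conversely, the least period itself yields a Pell solution, which is at
  -- least the smallest one.
  refine le_antisymm ?_ ?_
  · rw [← hsumk]
    exact Finset.sum_le_sum_of_subset_of_nonneg (Finset.range_mono hnk) fun i _ _ => (hApos i).le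
  · have hadapt := FormBasis.isAdapted_iterate hsq hx n
    have hflag := FormBasis.flag_iterate x n
    rw [hnx] at hflag
    have hsumn := FormBasis.sum_artanh_eq_logHeight hsq hx n
    have hsumpos : 0 < ∑ i ∈ Finset.range n, A (next^[i] x) :=
      Finset.sum_pos (fun i _ => hApos i) (Finset.nonempty_range_iff.2 hnpos.ne')
    set f := (FormBasis.step x)^[n] FormBasis.std
    have ha : 0 < a := by
      have := hx.1
      rw [hl] at this
      exact (mul_pos_iff_of_pos_left hg).1 this
    obtain ⟨U, hq, hs, ht, hTU⟩ :=
      FormBasis.exists_pell hg.ne' ha.ne' hl he hr hcop hadapt.det hflag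
    have hU : 0 ≤ U := by
      have := hadapt.q_nonneg
      rw [hq] at this
      exact (mul_nonneg_iff_of_pos_left ha).1 this
    have hT : 0 < f.p + f.t := by
      have h1 := hadapt.p_nonneg
      have h2 := hadapt.t_nonneg
      have h3 : (f.p + f.t) ^ 2 ≠ 0 := by nlinarith
      have h4 : f.p + f.t ≠ 0 := fun h => h3 (by rw [h]; rfl)
      omega
    have hh := FormBasis.logHeight_of_pell hx hg hl he hr hT hU (by linarith) hq hs (by linarith)
      hTU
    have hsumn' : ∑ i ∈ Finset.range n, A (next^[i] x) =
        2 * Real.log (((f.p + f.t : ℤ) + U * √((b ^ 2 - 4 * (a * c) : ℤ) : ℝ)) / 2) := by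
      rw [hA, hsumn, hh]
      ring
    -- U = 0 would give T = 2 and log 1 = 0, although the sum over a period is positive.
    have hU' : 0 < U := by
      refine lt_of_le_of_ne hU fun h0 => ?_
      rw [← h0] at hTU
      have h2 : f.p + f.t = 2 := by nlinarith
      rw [hsumn', ← h0, h2] at hsumpos
      norm_num at hsumpos
    have hle := hleast (show (f.p + f.t, U) ∈ pellSolutions _ from ⟨hT, hU', hTU⟩)
    have hle1 : (P.1 : ℝ) ≤ (f.p + f.t : ℤ) := by exact_mod_cast hle.1
    have hle2 : (P.2 : ℝ) ≤ U := by exact_mod_cast hle.2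
    have hP1 : (0 : ℝ) < P.1 := by exact_mod_cast hmem.1
    have hP2 : (0 : ℝ) < P.2 := by exact_mod_cast hmem.2.1
    rw [hsumn']
    gcongr

end EdgeFlag

/-! ### From flags back to topographs -/

namespace Topograph

variable {V : Type*} (T : Topograph V)

/-- The labels around a directed edge. -/
def flag (d : T.graph.Dart) : EdgeFlag :=
  ⟨T.label (T.leftRegion d), T.label (T.rightRegion d), T.label (T.backRegion d)⟩

theorem leftRegion_turnLeft (d : T.graph.Dart) :
    T.leftRegion (T.turnLeft d) = T.leftRegion d :=
  (Quot.sound (r := fun d d' => d' = T.turnLeft d) rfl).symm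

theorem flag_rot (d : T.graph.Dart) : T.flag (T.rot d) = (T.flag d).rot := by
  have h1 : T.rightRegion (T.rot d) = T.leftRegion d := by
    rw [PlaneCubicTree.rightRegion, ← T.leftRegion_turnLeft, PlaneCubicTree.turnLeft,
      SimpleGraph.Dart.symm_symm, T.rot_rot_rot]
  have h2 : T.backRegion (T.rot d) = T.rightRegion d := by
    rw [PlaneCubicTree.rightRegion, ← T.leftRegion_turnLeft, PlaneCubicTree.turnLeft,
      SimpleGraph.Dart.symm_symm]
    rfl
  simp only [flag, EdgeFlag.rot, h1, h2]
  rfl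

theorem flag_symm (d : T.graph.Dart) : T.flag d.symm = (T.flag d).symm := by
  have h1 : T.rightRegion d.symm = T.leftRegion d := by
    rw [PlaneCubicTree.rightRegion, SimpleGraph.Dart.symm_symm]
  have h2 : T.label (T.backRegion d.symm) = (T.flag d).front := by
    have := T.label_rule d
    simp only [EdgeFlag.front, flag]
    rw [← this, PlaneCubicTree.frontRegion]
    ring
  simp only [flag, EdgeFlag.symm, h1, h2]
  rfl

theorem closed_range_flag : EdgeFlag.Closed (Set.range T.flag) where
  rot := by
    rintro _ ⟨d, rfl⟩
    exact ⟨_, T.flag_rot d⟩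
  symm := by
    rintro _ ⟨d, rfl⟩
    exact ⟨_, T.flag_symm d⟩

theorem range_flag_subset (d : T.graph.Dart) {W : Set EdgeFlag} (hW : EdgeFlag.Closed W)
    (hd : T.flag d ∈ W) : Set.range T.flag ⊆ W := by
  rintro _ ⟨d', rfl⟩
  exact T.dart_induction (motive := fun d => T.flag d ∈ W) d hd
    (fun d h => by rw [flag_rot]; exact hW.rot _ h)
    (fun d h => by rw [flag_symm]; exact hW.symm _ h) d'

/-- Flags change by fixed rules under `rot` and `symm`, so an oriented automorphism that matches one
flag matches them all. -/
theorem exists_symmetry_of_flag_eq {d d' : T.graph.Dart} (h : T.flag d = T.flag d') :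
    ∃ φ : T.Symmetry, φ.toIso.toHom.mapDart d = d' := by
  obtain ⟨φ, hφ, hrot⟩ := T.exists_iso_mapDart d d'
  have hflag : (fun x => T.flag (φ.toHom.mapDart x)) = T.flag :=
    T.equivariant_ext EdgeFlag.symm EdgeFlag.rot d (by rw [hφ, h])
      (fun x => by rw [hrot, flag_rot]) (fun x => T.flag_symm (φ.toHom.mapDart x)) T.flag_rot T.flag_symm
  exact ⟨⟨φ, hrot, fun x => congrArg EdgeFlag.left (congrFun hflag x)⟩, hφ⟩

theorem Symmetry.flag_mapDart {T : Topograph V} (φ : T.Symmetry) (d : T.graph.Dart) :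
    T.flag (φ.toIso.toHom.mapDart d) = T.flag d := by
  refine EdgeFlag.ext (φ.label_map d) (φ.label_map d.symm) ?_
  change T.label (T.leftRegion (T.rot _)) = T.label (T.leftRegion (T.rot _))
  rw [← φ.map_rot, φ.label_map]

theorem starLabel_eq (D : ℤ) (d : T.graph.Dart) : T.starLabel D d = (T.flag d).star D := by
  have h : ∀ d, T.IsRightwardRiverEdge d ↔ (T.flag d).IsRiver := fun _ => Iff.rfl
  rw [starLabel, EdgeFlag.star]
  classical
  exact if_congr (h d) rfl (if_congr ((h d.symm).trans (by rw [flag_symm])) rfl rfl)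

theorem vertexTerm_snd (D : ℤ) (d : T.graph.Dart) :
    T.vertexTerm D d.snd = (T.flag d).frontTerm D := by
  rw [show d.snd = d.symm.fst from rfl, vertexTerm_eq, termAt, EdgeFlag.frontTerm, edgeSummand]
  simp only [starLabel_eq, flag_rot, flag_symm, EdgeFlag.rot_symm]
  rfl

theorem disc_flag {D : ℤ} (hT : T.HasDiscriminant D) (d : T.graph.Dart) :
    (T.flag d).disc = D := by
  rw [← hT d]
  have h : ∀ d, T.edgeLabel d = (T.flag d).edge := fun _ => rfl
  simp only [h, flag_rot]
  simp only [EdgeFlag.disc, EdgeFlag.edge, EdgeFlag.rot]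
  ring

/-- Each vertex is the final vertex of an edge that is directed away from the river or along it
rightwards. -/
theorem exists_isClimbing_or_isRiver {D : ℤ} (hD : 0 < D) (hsq : ¬ IsSquare D)
    (hT : T.HasDiscriminant D) (v : V) :
    ∃ d : T.graph.Dart, d.snd = v ∧ ((T.flag d).IsClimbing ∨ (T.flag d).IsRiver) := by
  obtain ⟨d, rfl⟩ := T.exists_dart v
  have hd := T.disc_flag hT d
  have h1 := EdgeFlag.left_ne_zero (x := T.flag d) (by rwa [hd])
  have h2 := EdgeFlag.right_ne_zero (x := T.flag d) (by rwa [hd])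
  have h3 := EdgeFlag.back_ne_zero (x := T.flag d) (by rwa [hd])
  have f1 : T.flag (T.rot d).symm = (T.flag d).rot.symm := by rw [flag_symm, flag_rot]
  have f2 : T.flag (T.rot (T.rot d)).symm = (T.flag d).rot.rot.symm := by
    rw [flag_symm, flag_rot, flag_rot]
  rcases EdgeFlag.exists_isClimbing_or_isRiver h1 h2 h3 (by rwa [hd]) with h | h | h
  · exact ⟨d.symm, rfl, by rwa [flag_symm]⟩
  · exact ⟨(T.rot d).symm, T.rot_fst d, by rwa [f1]⟩
  · exact ⟨(T.rot (T.rot d)).symm, (T.rot_fst _).trans (T.rot_fst d), by rwa [f2]⟩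

/-- At most one edge directed away from the river or along it rightwards ends at a vertex. -/
theorem eq_of_snd_eq {d d' : T.graph.Dart} (h : d.snd = d'.snd)
    (hd : (T.flag d).IsClimbing ∨ (T.flag d).IsRiver)
    (hd' : (T.flag d').IsClimbing ∨ (T.flag d').IsRiver) : d = d' := by
  have hR : T.flag (T.rot d.symm).symm = (T.flag d).turnRight.symm := by
    rw [flag_symm, flag_rot, flag_symm, EdgeFlag.rot_symm]
  have hL : T.flag (T.rot (T.rot d.symm)).symm = (T.flag d).turnLeft.symm := by
    rw [flag_symm, flag_rot, flag_rot, flag_symm, EdgeFlag.rot_rot_symm]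
  rcases T.eq_or_of_fst_eq d.symm d'.symm h.symm with e | e | e
  · exact (SimpleGraph.Dart.symm_involutive.injective e).symm
  · exfalso
    rw [show d' = (T.rot d.symm).symm by rw [← e, SimpleGraph.Dart.symm_symm], hR] at hd'
    simp only [EdgeFlag.IsClimbing, EdgeFlag.IsRiver, EdgeFlag.edge, EdgeFlag.turnRight,
      EdgeFlag.symm, EdgeFlag.front] at *
    omega
  · exfalso
    rw [show d' = (T.rot (T.rot d.symm)).symm by rw [← e, SimpleGraph.Dart.symm_symm], hL] at hd'
    simp only [EdgeFlag.IsClimbing, EdgeFlag.IsRiver, EdgeFlag.edge, EdgeFlag.turnLeft,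
      EdgeFlag.symm, EdgeFlag.front] at *
    omega

/-- The vertices modulo the river period correspond to the labels of the edges directed away from
the river or along it rightwards. -/
theorem hasSum_classTerm_iff {D : ℤ} (hD : 0 < D) (hsq : ¬ IsSquare D)
    (hT : T.HasDiscriminant D) (a : ℝ) :
    HasSum (T.classTerm D) a ↔
      HasSum (fun x : ↥(Set.range T.flag ∩ {x | x.IsClimbing ∨ x.IsRiver}) =>
        EdgeFlag.frontTerm D x.1) a := by
  -- The chosen dart does not matter: darts with equal flags differ by a symmetry, so their end
  -- vertices lie in one class.
  choose δ hδ using fun x : ↥(Set.range T.flag ∩ {x | x.IsClimbing ∨ x.IsRiver}) => x.2.1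
  let F : ↥(Set.range T.flag ∩ {x | x.IsClimbing ∨ x.IsRiver}) → T.VertexClass :=
    fun x => Quotient.mk T.riverSetoid (δ x).snd
  have hF : Function.Bijective F := by
    constructor
    · intro x y hxy
      obtain ⟨φ, hφ⟩ : ∃ φ : T.Symmetry, φ.toIso (δ x).snd = (δ y).snd := Quotient.exact hxy
      have h1 : T.flag (φ.toIso.toHom.mapDart (δ x)) = x.1 := by rw [φ.flag_mapDart, hδ]
      have h2 := T.eq_of_snd_eq (d := φ.toIso.toHom.mapDart (δ x)) (d' := δ y) hφ
        (by rw [h1]; exact x.2.2) (by rw [hδ]; exact y.2.2)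
      exact Subtype.ext (by rw [← h1, h2, hδ])
    · intro w
      induction w using Quotient.inductionOn with
      | _ v =>
        obtain ⟨d, rfl, hd⟩ := T.exists_isClimbing_or_isRiver hD hsq hT v
        refine ⟨⟨T.flag d, ⟨d, rfl⟩, hd⟩, Quotient.sound ?_⟩
        obtain ⟨φ, hφ⟩ := T.exists_symmetry_of_flag_eq (hδ ⟨T.flag d, ⟨d, rfl⟩, hd⟩)
        exact ⟨φ, congrArg (fun d => d.snd) hφ⟩
  rw [← (Equiv.ofBijective F hF).hasSum_iff]
  have : T.classTerm D ∘ Equiv.ofBijective F hF = fun x => EdgeFlag.frontTerm D x.1 := by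
    funext x
    change T.vertexTerm D (δ x).snd = _
    rw [vertexTerm_snd, hδ]
  rw [this]

theorem exists_isRiver {D : ℤ} (hD : 0 < D) (hsq : ¬ IsSquare D) (hT : T.HasDiscriminant D) :
    ∃ d : T.graph.Dart, (T.flag d).IsRiver := by
  obtain ⟨v⟩ := T.isTree.connected.nonempty
  obtain ⟨d, -, hd | hd⟩ := T.exists_isClimbing_or_isRiver hD hsq hT v
  · obtain ⟨_, ⟨d, rfl⟩, h⟩ := T.closed_range_flag.exists_isRiver (D := D) hD hsq (by
      rintro _ ⟨d, rfl⟩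
      exact T.disc_flag hT d) ⟨d, rfl⟩ hd
    exact ⟨d, h⟩
  · exact ⟨d, hd⟩

/-- Dividing the labels at a river edge by g gives a primitive form of discriminant D/g², to which
the evaluation over one period applies. -/
theorem hasSum_classTerm {D : ℤ} (hD : 0 < D) (hsq : ¬ IsSquare D) (hT : T.HasDiscriminant D)
    {g : ℕ} (hg : T.HasRegionGcd g) :
    HasSum (T.classTerm D) (2 * Real.log (pellUnit (D / (g : ℤ) ^ 2))) := by
  obtain ⟨d, hd⟩ := T.exists_isRiver hD hsq hT
  have hdisc := T.disc_flag hT d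
  have hgcd : Int.gcd (T.flag d).left (Int.gcd (T.flag d).back (T.flag d).right) = g := by
    have h1 : T.leftRegion (T.rot (T.rot d)) = T.rightRegion d := by
      rw [PlaneCubicTree.rightRegion, ← T.leftRegion_turnLeft d.symm, PlaneCubicTree.turnLeft,
        SimpleGraph.Dart.symm_symm]
    have := hg d
    rwa [h1] at this
  generalize hx : T.flag d = x at *
  have hg0 : (0 : ℤ) < g := by
    rw [← hgcd]
    exact_mod_cast Int.gcd_pos_of_ne_zero_left _ hd.1.ne'
  obtain ⟨a, ha⟩ : (g : ℤ) ∣ x.left := hgcd ▸ Int.gcd_dvd_left _ _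
  have hdvd : (g : ℤ) ∣ (Int.gcd x.back x.right : ℤ) := hgcd ▸ Int.gcd_dvd_right _ _
  obtain ⟨r, hr⟩ : (g : ℤ) ∣ x.back := hdvd.trans (Int.gcd_dvd_left _ _)
  obtain ⟨c, hc⟩ : (g : ℤ) ∣ x.right := hdvd.trans (Int.gcd_dvd_right _ _)
  have he : x.edge = g * (a + c - r) := by rw [EdgeFlag.edge, ha, hr, hc]; ring
  -- Two nested Bézout relations for the region labels, rewritten in terms of the sides and the edge
  -- label.
  have hcop : ∃ α β γ : ℤ, α * a + β * (a + c - r) + γ * c = 1 := by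
    have h1 := Int.gcd_eq_gcd_ab x.left (Int.gcd x.back x.right)
    have h2 := Int.gcd_eq_gcd_ab x.back x.right
    rw [hgcd] at h1
    generalize Int.gcdA x.left _ = u at h1
    generalize Int.gcdB x.left _ = v at h1
    rw [h2] at h1
    generalize Int.gcdA x.back x.right = w at h1
    generalize Int.gcdB x.back x.right = z at h1
    rw [ha, hr, hc] at h1
    have h3 : u * a + v * w * r + v * z * c = 1 := by
      apply mul_left_cancel₀ hg0.ne'
      linear_combination -h1
    exact ⟨u + v * w, -(v * w), v * z + v * w, by linear_combination h3⟩
  have hD' : D / (g : ℤ) ^ 2 = (a + c - r) ^ 2 - 4 * (a * c) := by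
    apply Int.ediv_eq_of_eq_mul_right (by positivity)
    rw [← hdisc, EdgeFlag.disc, he, ha, hc]
    ring
  have hS : ∀ y ∈ Set.range T.flag, y.disc = D := by
    rintro _ ⟨d, rfl⟩
    exact T.disc_flag hT d
  have hfin := EdgeFlag.finsum_artanh_eq_log_pellUnit T.closed_range_flag ⟨d, hx⟩
    (fun W hW hxW => T.range_flag_subset d hW (by rwa [hx])) (by rwa [hdisc]) hd hg0 ha he hc hcop
  rw [T.hasSum_classTerm_iff hD hsq hT, hD', ← hfin, hdisc]
  exact T.closed_range_flag.hasSum_frontTerm hD hsq hS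

end Topograph

theorem theorem9p3 {V : Type*} (T : Topograph V) (D : ℤ) (hD : 0 < D) (hsq : ¬ IsSquare D)
    (hT : T.HasDiscriminant D) :
    (T.IsPrimitive → HasSum (T.classTerm D) (2 * Real.log (pellUnit D))) ∧
    (∀ g : ℕ, T.HasRegionGcd g →
      HasSum (T.classTerm D) (2 * Real.log (pellUnit (D / (g : ℤ) ^ 2)))) :=
  ⟨fun h => by simpa using T.hasSum_classTerm hD hsq hT h,
    fun _ h => T.hasSum_classTerm hD hsq hT h⟩
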